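/- **Setting.** Let $R$ be the closed unit disk $D$ or the whole plane $\mathbb R^2$, and let $B$ be a finite set of points of the boundary circle of $R$ ($B=\emptyset$ if $R=\mathbb R^2$). A *smoothing with boundary $B$* is a compact smooth $1$-dimensional submanifold of $R$ (a finite disjoint union of simple arcs and simple closed curves) meeting the boundary circle transversally and exactly in $B$. The category $\mathcal{C}ob^3(B)$ has these smoothings as objects. A morphism $\gamma\to\gamma'$ is a compact smooth surface embedded in $R\times[0,1]$ with top boundary $\gamma\times\{1\}$, bottom boundary $\gamma'\times\{0\}$, vertical near the top and the bottom, and meeting the wall $\partial R\times[0,1]$ in the vertical segments $B\times[0,1]$, transversally; surfaces are regarded up to boundary-preserving smooth ambient isotopy (fixed near top and bottom, preserving every vertical line of the wall). Composition places one cobordism atop the other. $\mathcal{C}ob^3(B)$ is made pre-additive by allowing formal $\mathbb Z$-linear combinations of morphisms, and $\operatorname{Mat}(\mathcal{C}ob^3(B))$ is its additive closure: objects are finite formal direct sums of objects, morphisms are matrices of morphisms. Let $T$ be an oriented tangle diagram in $D$, or a knot or link diagram in $\mathbb R^2$, with $\partial T=B$, with $n$ ordered crossings, $n_+$ of them positive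 and $n_-$ negative. Each crossing is given with a disk neighborhood, these being disjoint, in which $T$ is diffeomorphic to the union of the two coordinate axes. For $v\in\{0,1\}^n$ let $T_v$ be the smoothing obtained by replacing the $i$-th crossing, inside its neighborhood, by its $v_i$-smoothing; here the $0$-smoothing (resp. $1$-smoothing) is the one in which one enters along the lower (resp. upper) strand and turns right. Let $|v|=\sum_i v_i$. If $v_j=0$ and $w$ is obtained from $v$ by changing $v_j$ to $1$, let $S_{v,w}\colon T_v\to T_w$ be the cobordism that is $T_v\times[0,1]$ outside the neighborhood of the $j$-th crossing and a saddle inside it. The formal Khovanov bracket $[[T]]$ is the chain in $\operatorname{Mat}(\mathcal{C}ob^3(\partial T))$ with $$[[T]]^{r}=\bigoplus_{|v|=r+n_-}T_v ,\qquad d^r\colon[[T]]^{r}\to[[T]]^{r+1},$$ where the matrix entry of $d^r$ from $T_v$ to $T_w$ is $(-1)^{\sum_{i<j}v_i}\,S_{v,w}$ if $w$ is obtained from $v$ by changing one coordinate $v_j$ from $0$ to $1$, and $0$ otherwise. **Proposition.** For every such diagram $T$, the chain $[[T]]$ is a complex in $\operatorname{Kom}(\operatorname{Mat}(\mathcal{C}ob^3(\partial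 T)))$: it has finite length, $[[T]]^r=0$ for $r\notin[-n_-,n_+]$, and $$d^{r}\circ d^{r-1}=0\qquad\text{for all } r\in\mathbb Z .$$ -/

import Mathlib

open CategoryTheory Set
open scoped ContDiff Topology

namespace TangleBracket

noncomputable section

/-! ### Smooth reparametrizations of the vertical direction -/

theorem exists_fiber_inverse {E : Type*} [NormedAddCommGroup E] [NormedSpace ℝ E]
    [CompleteSpace E] (θ : E × ℝ → ℝ) (hθ : ContDiff ℝ ∞ θ)
    (hpos : ∀ x, fderiv ℝ θ x (0, 1) ≠ 0)
    (hbij : ∀ e, Function.Bijective fun z => θ (e, z)) :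
    ∃ G : E × ℝ → ℝ, ContDiff ℝ ∞ G ∧ (∀ e z, G (e, θ (e, z)) = z) ∧
      ∀ e z, θ (e, G (e, z)) = z := by
  choose g hg using fun e => Function.bijective_iff_has_inverse.1 (hbij e)
  let F : E × ℝ → E × ℝ := fun x => (x.1, θ x)
  let G : E × ℝ → E × ℝ := fun x => (x.1, g x.1 x.2)
  have hGF : ∀ x, G (F x) = x := fun x => Prod.ext rfl ((hg x.1).1 x.2)
  have hFG : ∀ x, F (G x) = x := fun x => Prod.ext rfl ((hg x.1).2 x.2)
  have hF : ContDiff ℝ ∞ F := contDiff_fst.prodMk hθ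
  have key : ContDiff ℝ ∞ G := by
    rw [contDiff_iff_contDiffAt]
    intro y
    let x := G y
    let A : (E × ℝ) →L[ℝ] ℝ := fderiv ℝ θ x
    let c : ℝ := A (0, 1)
    have hc : c ≠ 0 := hpos x
    have hA : ∀ e z, A (e, z) = A (e, 0) + z * c := by
      intro e z
      have : ((e, z) : E × ℝ) = (e, 0) + z • (0, 1) := by simp
      rw [this, map_add, map_smul, smul_eq_mul]
    let P : (E × ℝ) →L[ℝ] (E × ℝ) := (ContinuousLinearMap.fst ℝ E ℝ).prod A
    let Q : (E × ℝ) →L[ℝ] (E × ℝ) := (ContinuousLinearMap.fst ℝ E ℝ).prod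
      (c⁻¹ • (ContinuousLinearMap.snd ℝ E ℝ -
        A.comp ((ContinuousLinearMap.inl ℝ E ℝ).comp (ContinuousLinearMap.fst ℝ E ℝ))))
    have hPQ : Function.LeftInverse Q P := by
      rintro ⟨e, z⟩
      simp only [P, Q, ContinuousLinearMap.prod_apply, ContinuousLinearMap.coe_fst',
        _root_.smul_apply, _root_.sub_apply,
        ContinuousLinearMap.coe_snd', ContinuousLinearMap.comp_apply,
        ContinuousLinearMap.inl_apply, smul_eq_mul]
      rw [hA e z]
      ext
      · rfl
      · simp only; field_simp; ring
    have hQP : Function.RightInverse Q P := by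
      rintro ⟨e, z⟩
      simp only [P, Q, ContinuousLinearMap.prod_apply, ContinuousLinearMap.coe_fst',
        _root_.smul_apply, _root_.sub_apply,
        ContinuousLinearMap.coe_snd', ContinuousLinearMap.comp_apply,
        ContinuousLinearMap.inl_apply, smul_eq_mul]
      rw [hA]
      ext
      · rfl
      · simp only; field_simp; ring
    let f' : (E × ℝ) ≃L[ℝ] (E × ℝ) := ContinuousLinearEquiv.equivOfInverse P Q hPQ hQP
    have hFx : ContDiffAt ℝ ∞ F x := hF.contDiffAt
    have hn : (∞ : WithTop ℕ∞) ≠ 0 := by simp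
    have hd : HasFDerivAt F (f' : (E × ℝ) →L[ℝ] (E × ℝ)) x := by
      have h1 : HasFDerivAt θ A x := (hθ.differentiable hn x).hasFDerivAt
      exact (hasFDerivAt_fst (𝕜 := ℝ) (p := x)).prodMk h1
    have hloc := hFx.to_localInverse hd hn
    have hFxy : F x = y := hFG y
    rw [hFxy] at hloc
    refine hloc.congr_of_eventuallyEq ?_
    have hs := hFx.hasStrictFDerivAt' hd hn
    have hev := hs.eventually_right_inverse
    rw [hFxy] at hev
    filter_upwards [hev] with w hw
    have : G (F (hs.localInverse F f' x w)) = G w := congrArg G hw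
    rw [hGF] at this
    exact this.symm
  exact ⟨fun x => (G x).2, contDiff_snd.comp key, fun e z => (hg e).1 z, fun e z => (hg e).2 z⟩

/-- Smooth functions on the line with positive derivative. -/
def IsRepar (h : ℝ → ℝ) : Prop := ContDiff ℝ ∞ h ∧ ∀ z, 0 < deriv h z

theorem IsRepar.strictMono {h : ℝ → ℝ} (hh : IsRepar h) : StrictMono h :=
  strictMono_of_deriv_pos hh.2

/-- Two increasing affine functions can be joined smoothly inside a prescribed interval. -/
theorem exists_join {a b A B m n : ℝ} (hab : a < b) (hAB : A < B) (hm : 0 < m) (hn : 0 < n) :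
    ∃ h, IsRepar h ∧ (∀ z, z ≤ a → h z = A + m * (z - a)) ∧
      ∀ z, b ≤ z → h z = B + n * (z - b) := by
  let S := Real.smoothTransition
  have hSc : Continuous S := Real.smoothTransition.continuous
  have hSs : ContDiff ℝ ∞ S := Real.smoothTransition.contDiff
  have hS0 : ∀ x, x ≤ 0 → S x = 0 := fun x hx => Real.smoothTransition.zero_of_nonpos hx
  have hS1 : ∀ x, 1 ≤ x → S x = 1 := fun x hx => Real.smoothTransition.one_of_one_le hx
  have hSn : ∀ x, 0 ≤ S x := Real.smoothTransition.nonneg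
  have hSl : ∀ x, S x ≤ 1 := Real.smoothTransition.le_one
  have hSp : ∀ x, 0 < x → 0 < S x := fun x hx => Real.smoothTransition.pos_of_pos hx
  obtain ⟨δ, hδ, hδ1, hδ2⟩ : ∃ δ : ℝ, 0 < δ ∧ δ ≤ b - a ∧ (m + n) * δ < B - A := by
    refine ⟨min (b - a) ((B - A) / (2 * (m + n))), ?_, min_le_left _ _, ?_⟩
    · refine lt_min (by linarith) (div_pos (by linarith) (by linarith))
    · have h1 := min_le_right (b - a) ((B - A) / (2 * (m + n)))
      have h2 : (m + n) * ((B - A) / (2 * (m + n))) = (B - A) / 2 := by field_simp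
      nlinarith
  let g1 : ℝ → ℝ := fun z => m * (1 - S ((z - a) / δ))
  let g2 : ℝ → ℝ := fun z => n * S ((z - (b - δ)) / δ)
  let g3 : ℝ → ℝ := fun z => S ((z - a) / δ) * S ((b - z) / δ)
  have c1 : Continuous g1 := by fun_prop
  have c2 : Continuous g2 := by fun_prop
  have c3 : Continuous g3 := by fun_prop
  have i (f : ℝ → ℝ) (hf : Continuous f) (x y : ℝ) :
      IntervalIntegrable f MeasureTheory.volume x y := hf.intervalIntegrable x y
  have I1 : ∫ z in a..b, g1 z ≤ m * δ := by
    rw [← intervalIntegral.integral_add_adjacent_intervals (i g1 c1 a (a + δ))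
      (i g1 c1 (a + δ) b)]
    have e2 : ∫ z in (a + δ)..b, g1 z = 0 := by
      rw [intervalIntegral.integral_congr (g := fun _ => (0 : ℝ))]
      · simp
      · intro z hz
        rw [uIcc_of_le (by linarith)] at hz
        have : 1 ≤ (z - a) / δ := by rw [le_div_iff₀ hδ]; linarith [hz.1]
        simp only [g1]; rw [hS1 _ this]; ring
    have e1 : ∫ z in a..(a + δ), g1 z ≤ ∫ z in a..(a + δ), m := by
      refine intervalIntegral.integral_mono_on (by linarith) (i _ c1 _ _)
        (i _ continuous_const _ _) fun z _ => ?_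
      have := hSn ((z - a) / δ)
      simp only [g1]; nlinarith
    rw [intervalIntegral.integral_const, smul_eq_mul] at e1
    linarith
  have I2 : ∫ z in a..b, g2 z ≤ n * δ := by
    rw [← intervalIntegral.integral_add_adjacent_intervals (i g2 c2 a (b - δ))
      (i g2 c2 (b - δ) b)]
    have e2 : ∫ z in a..(b - δ), g2 z = 0 := by
      rw [intervalIntegral.integral_congr (g := fun _ => (0 : ℝ))]
      · simp
      · intro z hz
        rw [uIcc_of_le (by linarith)] at hz
        have : (z - (b - δ)) / δ ≤ 0 := div_nonpos_of_nonpos_of_nonneg (by linarith [hz.2]) hδ.le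
        simp only [g2]; rw [hS0 _ this]; ring
    have e1 : ∫ z in (b - δ)..b, g2 z ≤ ∫ z in (b - δ)..b, n := by
      refine intervalIntegral.integral_mono_on (by linarith) (i _ c2 _ _)
        (i _ continuous_const _ _) fun z _ => ?_
      have := hSl ((z - (b - δ)) / δ)
      simp only [g2]; nlinarith
    rw [intervalIntegral.integral_const, smul_eq_mul] at e1
    linarith
  have p3 : ∀ z, a < z → z < b → 0 < g3 z := fun z h1 h2 =>
    mul_pos (hSp _ (div_pos (by linarith) hδ)) (hSp _ (div_pos (by linarith) hδ))
  have I3 : 0 < ∫ z in a..b, g3 z :=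
    intervalIntegral.intervalIntegral_pos_of_pos_on (i g3 c3 a b) (fun z hz => p3 z hz.1 hz.2) hab
  let K : ℝ := (B - A - (∫ z in a..b, g1 z) - ∫ z in a..b, g2 z) / ∫ z in a..b, g3 z
  have hK : 0 < K := div_pos (by nlinarith) I3
  let g : ℝ → ℝ := fun z => g1 z + g2 z + K * g3 z
  have cg : Continuous g := by fun_prop
  have sg : ContDiff ℝ ∞ g := by
    have l1 : ContDiff ℝ ∞ fun z : ℝ => S ((z - a) / δ) := hSs.comp (by fun_prop)
    have l2 : ContDiff ℝ ∞ fun z : ℝ => S ((z - (b - δ)) / δ) := hSs.comp (by fun_prop)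
    have l3 : ContDiff ℝ ∞ fun z : ℝ => S ((b - z) / δ) := hSs.comp (by fun_prop)
    exact ((contDiff_const.mul (contDiff_const.sub l1)).add (contDiff_const.mul l2)).add
      (contDiff_const.mul (l1.mul l3))
  have n1 : ∀ z, 0 ≤ g1 z := fun z => mul_nonneg hm.le (by linarith [hSl ((z - a) / δ)])
  have n2 : ∀ z, 0 ≤ g2 z := fun z => mul_nonneg hn.le (hSn _)
  have n3 : ∀ z, 0 ≤ g3 z := fun z => mul_nonneg (hSn _) (hSn _)
  have gl : ∀ z, z ≤ a → g z = m := by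
    intro z hz
    have h1 : (z - a) / δ ≤ 0 := div_nonpos_of_nonpos_of_nonneg (by linarith) hδ.le
    have h2 : (z - (b - δ)) / δ ≤ 0 := div_nonpos_of_nonpos_of_nonneg (by linarith) hδ.le
    simp only [g, g1, g2, g3]; rw [hS0 _ h1, hS0 _ h2]; ring
  have gr : ∀ z, b ≤ z → g z = n := by
    intro z hz
    have h1 : 1 ≤ (z - a) / δ := by rw [le_div_iff₀ hδ]; linarith
    have h2 : 1 ≤ (z - (b - δ)) / δ := by rw [le_div_iff₀ hδ]; linarith
    have h3 : (b - z) / δ ≤ 0 := div_nonpos_of_nonpos_of_nonneg (by linarith) hδ.le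
    simp only [g, g1, g2, g3]; rw [hS1 _ h1, hS1 _ h2, hS0 _ h3]; ring
  have gpos : ∀ z, 0 < g z := by
    intro z
    rcases le_or_gt z a with h1 | h1
    · rw [gl z h1]; exact hm
    rcases le_or_gt b z with h2 | h2
    · rw [gr z h2]; exact hn
    have := mul_pos hK (p3 z h1 h2)
    have := n1 z
    have := n2 z
    simp only [g]; linarith
  have Ig : ∫ z in a..b, g z = B - A := by
    have : ∫ z in a..b, g z =
        (∫ z in a..b, g1 z) + (∫ z in a..b, g2 z) + K * ∫ z in a..b, g3 z := by
      have q1 : Continuous fun z => g1 z + g2 z := c1.add c2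
      have q3 : Continuous fun z => K * g3 z := continuous_const.mul c3
      simp only [g]
      rw [intervalIntegral.integral_add (i _ q1 a b) (i _ q3 a b),
        intervalIntegral.integral_add (i _ c1 a b) (i _ c2 a b),
        intervalIntegral.integral_const_mul K g3]
    rw [this, div_mul_cancel₀ _ I3.ne']; ring
  have hder : ∀ z, HasDerivAt (fun z => A + ∫ x in a..z, g x) (g z) z := fun z =>
    (cg.integral_hasStrictDerivAt a z).hasDerivAt.const_add A
  have hdg : deriv (fun z => A + ∫ x in a..z, g x) = g := funext fun z => (hder z).deriv
  refine ⟨fun z => A + ∫ x in a..z, g x, ⟨?_, ?_⟩, ?_, ?_⟩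
  · rw [contDiff_infty_iff_deriv, hdg]
    exact ⟨fun z => (hder z).differentiableAt, sg⟩
  · intro z; rw [hdg]; exact gpos z
  · intro z hz
    have : ∫ x in a..z, g x = ∫ x in a..z, m := by
      refine intervalIntegral.integral_congr fun x hx => gl x ?_
      rw [uIcc_of_ge hz] at hx; exact hx.2
    simp only [this, intervalIntegral.integral_const, smul_eq_mul]; ring
  · intro z hz
    have : ∫ x in b..z, g x = ∫ x in b..z, n := by
      refine intervalIntegral.integral_congr fun x hx => gr x ?_
      rw [uIcc_of_le hz] at hx; exact hx.1
    simp only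
    rw [← intervalIntegral.integral_add_adjacent_intervals (i g cg a b) (i g cg b z), Ig, this,
      intervalIntegral.integral_const, smul_eq_mul]; ring

theorem IsRepar.glue {h k : ℝ → ℝ} (hh : IsRepar h) (hk : IsRepar k) {a b c : ℝ}
    (hac : a < c) (hcb : c < b) (heq : ∀ z, a ≤ z → z ≤ b → h z = k z) :
    IsRepar fun z => if z ≤ c then h z else k z := by
  have e1 : ∀ z, z < b → (fun z => if z ≤ c then h z else k z) =ᶠ[𝓝 z] h := by
    intro z hz
    filter_upwards [Iio_mem_nhds hz] with w hw
    split_ifs with h1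
    · rfl
    · exact (heq w (by linarith) (le_of_lt hw)).symm
  have e2 : ∀ z, b ≤ z → (fun z => if z ≤ c then h z else k z) =ᶠ[𝓝 z] k := by
    intro z hz
    filter_upwards [Ioi_mem_nhds (show c < z by linarith)] with w hw
    rw [if_neg (not_le.2 hw)]
  refine ⟨contDiff_iff_contDiffAt.2 fun z => ?_, fun z => ?_⟩
  · rcases lt_or_ge z b with hz | hz
    · exact hh.1.contDiffAt.congr_of_eventuallyEq (e1 z hz)
    · exact hk.1.contDiffAt.congr_of_eventuallyEq (e2 z hz)
  · rcases lt_or_ge z b with hz | hz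
    · rw [(e1 z hz).deriv_eq]; exact hh.2 z
    · rw [(e2 z hz).deriv_eq]; exact hk.2 z

/-! ### The plane, the cylinder, smoothings and cobordisms -/

abbrev Plane : Type := ℝ × ℝ

/-- Three-space; the last coordinate is the vertical one. -/
abbrev Space : Type := Plane × ℝ

/-- The planar region in which diagrams are drawn: the closed unit disk (for tangles),
or the whole plane (for knots and links). -/
inductive Region where
  | disk : Region
  | plane : Region

def Region.carrier : Region → Set Plane
  | .disk => {p | p.1 ^ 2 + p.2 ^ 2 ≤ 1}
  | .plane => univ

def Region.boundary : Region → Set Plane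
  | .disk => {p | p.1 ^ 2 + p.2 ^ 2 = 1}
  | .plane => ∅

theorem Region.boundary_subset (R : Region) : R.boundary ⊆ R.carrier := by
  cases R
  · intro p hp; exact le_of_eq hp
  · exact empty_subset _

/-- Near `p`, the set `γ` is a smooth one-dimensional submanifold of the region: the zero set of a
smooth function with nonzero differential. If `p` lies on the boundary circle then `γ` is
transverse to the circle there, `(-p.2, p.1)` being the tangent direction of the circle. -/
def CurveAt (R : Region) (γ : Set Plane) (p : Plane) : Prop :=
  ∃ U : Set Plane, IsOpen U ∧ p ∈ U ∧ ∃ f : Plane → ℝ, ContDiffOn ℝ ∞ f U ∧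
    fderiv ℝ f p ≠ 0 ∧ (p ∈ R.boundary → fderiv ℝ f p (-p.2, p.1) ≠ 0) ∧
    ∀ q ∈ U, q ∈ γ ↔ q ∈ R.carrier ∧ f q = 0

/-- Near `x`, the set `C` is a smooth surface in the cylinder `R × [0, 1]`: the zero set of a
smooth function with nonzero differential. On the vertical wall it is transverse to the horizontal
circle. -/
def SurfaceAt (R : Region) (C : Set Space) (x : Space) : Prop :=
  ∃ U : Set Space, IsOpen U ∧ x ∈ U ∧ ∃ f : Space → ℝ, ContDiffOn ℝ ∞ f U ∧
    fderiv ℝ f x ≠ 0 ∧ (x.1 ∈ R.boundary → fderiv ℝ f x ((-x.1.2, x.1.1), 0) ≠ 0) ∧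
    ∀ y ∈ U, y ∈ C ↔ y.1 ∈ R.carrier ∧ y.2 ∈ Icc (0 : ℝ) 1 ∧ f y = 0

/-- A smoothing with boundary `B`: a compact smooth curve (a disjoint union of finitely many
simple arcs and simple closed curves) in the region, meeting the boundary circle exactly in `B`,
transversally. -/
structure Smoothing (R : Region) (B : Finset Plane) where
  carrier : Set Plane
  isCompact : IsCompact carrier
  subset : carrier ⊆ R.carrier
  curveAt : ∀ p ∈ carrier, CurveAt R carrier p
  boundary : ∀ p ∈ R.boundary, p ∈ carrier ↔ p ∈ B

/-- An embedded cobordism from `γ` (at the top, height `1`) to `γ'` (at the bottom, height `0`):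
a compact smooth surface in the cylinder `R × [0, 1]`, meeting the wall of the cylinder in the
vertical segments over `B`, and vertical in collars of the top and of the bottom. -/
structure EmbeddedCobordism {R : Region} {B : Finset Plane} (γ γ' : Smoothing R B) where
  carrier : Set Space
  isCompact : IsCompact carrier
  subset : ∀ x ∈ carrier, x.1 ∈ R.carrier ∧ x.2 ∈ Icc (0 : ℝ) 1
  surfaceAt : ∀ x ∈ carrier, SurfaceAt R carrier x
  wall : ∀ p ∈ R.boundary, ∀ z ∈ Icc (0 : ℝ) 1, (p, z) ∈ carrier ↔ p ∈ B
  top : ∃ ε > 0, ε < 1 ∧ ∀ p z, 1 - ε ≤ z → z ≤ 1 → ((p, z) ∈ carrier ↔ p ∈ γ.carrier)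
  bottom : ∃ ε > 0, ε < 1 ∧ ∀ p z, 0 ≤ z → z ≤ ε → ((p, z) ∈ carrier ↔ p ∈ γ'.carrier)

/-- Boundary-preserving smooth ambient isotopy in the cylinder `R × [0, 1]`: a smooth family
`Φ (t, ·)` of diffeomorphisms of three-space (with inverses `Ψ (t, ·)`) starting at the identity,
preserving the cylinder over `R`, mapping each vertical line of its wall to itself, and equal to
the identity near the top and the bottom of the cylinder and beyond, such that `Φ (1, ·)` carries
`C` to `C'`. -/
def IsIsotopic (R : Region) (C C' : Set Space) : Prop :=
  ∃ Φ Ψ : ℝ × Space → Space, ContDiff ℝ ∞ Φ ∧ ContDiff ℝ ∞ Ψ ∧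
    (∀ t x, Ψ (t, Φ (t, x)) = x) ∧ (∀ t x, Φ (t, Ψ (t, x)) = x) ∧
    (∀ x, Φ (0, x) = x) ∧
    (∀ t x, (Φ (t, x)).1 ∈ R.carrier ↔ x.1 ∈ R.carrier) ∧
    (∀ q ∈ R.boundary, ∀ t x, (Φ (t, x)).1 = q ↔ x.1 = q) ∧
    (∃ ε > 0, ∀ t x, x.2 ≤ ε ∨ 1 - ε ≤ x.2 → Φ (t, x) = x) ∧
    (fun x => Φ (1, x)) '' C = C'

theorem IsIsotopic.refl (R : Region) (C : Set Space) : IsIsotopic R C C :=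
  ⟨fun x => x.2, fun x => x.2, contDiff_snd, contDiff_snd, fun _ _ => rfl, fun _ _ => rfl,
    fun _ => rfl, fun _ _ => Iff.rfl, fun _ _ _ _ => Iff.rfl, ⟨1, one_pos, fun _ _ _ => rfl⟩,
    image_id' C⟩

theorem IsIsotopic.symm {R : Region} {C C' : Set Space} (h : IsIsotopic R C C') :
    IsIsotopic R C' C := by
  obtain ⟨Φ, Ψ, hΦ, hΨ, h1, h2, h0, hR, hw, ⟨ε, hε, he⟩, hC⟩ := h
  refine ⟨Ψ, Φ, hΨ, hΦ, h2, h1, fun x => ?_, fun t x => ?_, fun q hq t x => ?_,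
    ⟨ε, hε, fun t x hx => ?_⟩, ?_⟩
  · have := h1 0 x; rwa [h0] at this
  · rw [← hR t (Ψ (t, x)), h2]
  · rw [← hw q hq t (Ψ (t, x)), h2]
  · have := h1 t x; rwa [he t x hx] at this
  · rw [← hC, image_image]
    simp only [h1, image_id']

theorem IsIsotopic.trans {R : Region} {C C' C'' : Set Space} (h : IsIsotopic R C C')
    (k : IsIsotopic R C' C'') : IsIsotopic R C C'' := by
  obtain ⟨Φ, Ψ, hΦ, hΨ, h1, h2, h0, hR, hw, ⟨ε, hε, he⟩, hC⟩ := h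
  obtain ⟨Φ', Ψ', hΦ', hΨ', h1', h2', h0', hR', hw', ⟨ε', hε', he'⟩, hC'⟩ := k
  refine ⟨fun y => Φ' (y.1, Φ y), fun y => Ψ (y.1, Ψ' y), hΦ'.comp (contDiff_fst.prodMk hΦ),
    hΨ.comp (contDiff_fst.prodMk hΨ'), fun t x => ?_, fun t x => ?_, fun x => ?_, fun t x => ?_,
    fun q hq t x => ?_, ⟨min ε ε', lt_min hε hε', fun t x hx => ?_⟩, ?_⟩
  · simp only [h1', h1]
  · simp only [h2', h2]
  · simp only [h0', h0]
  · simp only [hR', hR]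
  · simp only [hw' q hq, hw q hq]
  · have a1 := min_le_left ε ε'
    have a2 := min_le_right ε ε'
    have hx1 : x.2 ≤ ε ∨ 1 - ε ≤ x.2 := hx.imp (fun h => by linarith) fun h => by linarith
    have hx2 : x.2 ≤ ε' ∨ 1 - ε' ≤ x.2 := hx.imp (fun h => by linarith) fun h => by linarith
    simp only [he t x hx1, he' t x hx2]
  · rw [← hC', ← hC, image_image]

/-- A vertical reparametrization of the cylinder gives isotopic sets. -/
theorem isIsotopic_of_vertical {R : Region} {C C' : Set Space} (h : Space → ℝ)
    (hs : ContDiff ℝ ∞ h) (hd : ∀ p z, 0 < deriv (fun z => h (p, z)) z)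
    {ε : ℝ} (hε : 0 < ε) (hid : ∀ p z, z ≤ ε ∨ 1 - ε ≤ z → h (p, z) = z)
    (hC : ∀ p z, (p, z) ∈ C ↔ (p, h (p, z)) ∈ C') : IsIsotopic R C C' := by
  let S := Real.smoothTransition
  have hSs : ContDiff ℝ ∞ S := Real.smoothTransition.contDiff
  have hS0 : ∀ t, 0 ≤ S t := Real.smoothTransition.nonneg
  have hS1 : ∀ t, S t ≤ 1 := Real.smoothTransition.le_one
  let θ : (ℝ × Plane) × ℝ → ℝ := fun y => y.2 + S y.1.1 * (h (y.1.2, y.2) - y.2)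
  have hθ : ContDiff ℝ ∞ θ := by
    have l1 : ContDiff ℝ ∞ fun y : (ℝ × Plane) × ℝ => S y.1.1 := hSs.comp (by fun_prop)
    have l2 : ContDiff ℝ ∞ fun y : (ℝ × Plane) × ℝ => h (y.1.2, y.2) := hs.comp (by fun_prop)
    exact contDiff_snd.add (l1.mul (l2.sub contDiff_snd))
  have hn : (∞ : WithTop ℕ∞) ≠ 0 := by simp
  have hθd : ∀ e z, HasDerivAt (fun z => θ (e, z))
      (1 + S e.1 * (deriv (fun z => h (e.2, z)) z - 1)) z := by
    intro e z
    have hz : DifferentiableAt ℝ (fun z => h (e.2, z)) z :=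
      ((hs.comp (contDiff_prodMk_right e.2)).differentiable hn) z
    exact (hasDerivAt_id z).add (((hz.hasDerivAt.sub (hasDerivAt_id z))).const_mul (S e.1))
  have hpos : ∀ (e : ℝ × Plane) z, 0 < 1 + S e.1 * (deriv (fun z => h (e.2, z)) z - 1) := by
    intro e z
    have h1 := hd e.2 z
    have h2 := hS0 e.1
    have h3 := hS1 e.1
    rcases eq_or_lt_of_le h2 with h4 | h4
    · rw [← h4]; norm_num
    · nlinarith [mul_pos h4 h1]
  have hθid : ∀ (e : ℝ × Plane) z, z ≤ ε ∨ 1 - ε ≤ z → θ (e, z) = z := by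
    intro e z hz
    simp only [θ, hid e.2 z hz]; ring
  have hcont : ∀ e, Continuous fun z => θ (e, z) := fun e =>
    hθ.continuous.comp (by fun_prop)
  have hbij : ∀ e, Function.Bijective fun z => θ (e, z) := by
    intro e
    refine ⟨(strictMono_of_deriv_pos fun z => ?_).injective, fun w => ?_⟩
    · rw [(hθd e z).deriv]; exact hpos e z
    · have h1 : θ (e, min w ε) = min w ε := hθid e _ (Or.inl (min_le_right _ _))
      have h2 : θ (e, max w (1 - ε)) = max w (1 - ε) := hθid e _ (Or.inr (le_max_right _ _))
      have h3 : min w ε ≤ max w (1 - ε) := (min_le_left _ _).trans (le_max_left _ _)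
      have := intermediate_value_Icc h3 (hcont e).continuousOn
      obtain ⟨z, -, hz⟩ := this (show w ∈ Icc _ _ by
        simp only [h1, h2]; exact ⟨min_le_left _ _, le_max_left _ _⟩)
      exact ⟨z, hz⟩
  have hf : ∀ x, fderiv ℝ θ x (0, 1) ≠ 0 := by
    rintro ⟨e, z⟩
    have h1 : HasDerivAt (fun z => θ (e, z)) (fderiv ℝ θ (e, z) (0, 1)) z :=
      (hθ.differentiable hn (e, z)).hasFDerivAt.comp_hasDerivAt z
        ((hasDerivAt_const z e).prodMk (hasDerivAt_id z))
    rw [h1.unique (hθd e z)]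
    exact (hpos e z).ne'
  obtain ⟨G, hG, hG1, hG2⟩ := exists_fiber_inverse θ hθ hf hbij
  refine ⟨fun y => (y.2.1, θ ((y.1, y.2.1), y.2.2)), fun y => (y.2.1, G ((y.1, y.2.1), y.2.2)),
    ?_, ?_, fun t x => ?_, fun t x => ?_, fun x => ?_, fun _ _ => Iff.rfl, fun _ _ _ _ => Iff.rfl,
    ⟨ε, hε, fun t x hx => ?_⟩, ?_⟩
  · exact (by fun_prop : ContDiff ℝ ∞ fun y : ℝ × Space => y.2.1).prodMk
      (hθ.comp (by fun_prop : ContDiff ℝ ∞ fun y : ℝ × Space => ((y.1, y.2.1), y.2.2)))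
  · exact (by fun_prop : ContDiff ℝ ∞ fun y : ℝ × Space => y.2.1).prodMk
      (hG.comp (by fun_prop : ContDiff ℝ ∞ fun y : ℝ × Space => ((y.1, y.2.1), y.2.2)))
  · exact Prod.ext rfl (hG1 _ _)
  · exact Prod.ext rfl (hG2 _ _)
  · refine Prod.ext rfl ?_
    simp only [θ, S, Real.smoothTransition.zero]; ring
  · exact Prod.ext rfl (hθid _ _ hx)
  · have hθ1 : ∀ p z, θ ((1, p), z) = h (p, z) := by
      intro p z; simp only [θ, S, Real.smoothTransition.one]; ring
    ext ⟨p, w⟩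
    constructor
    · rintro ⟨⟨p', z⟩, hx, he⟩
      simp only [hθ1, Prod.mk.injEq] at he
      obtain ⟨rfl, rfl⟩ := he
      exact (hC p' z).1 hx
    · intro hx
      obtain ⟨z, hz⟩ := (hbij (1, p)).2 w
      simp only [hθ1] at hz
      refine ⟨(p, z), (hC p z).2 (by rw [hz]; exact hx), ?_⟩
      simp only [hθ1, hz]

/-- The image of an isotopy under a vertical affine embedding of the cylinder into itself. -/
theorem IsIsotopic.stack {R : Region} {C C' D : Set Space} {a : ℝ} (ha : 0 ≤ a) (ha' : a ≤ 1 / 2)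
    (h : IsIsotopic R C C')
    (hD : ∀ x ∈ D, x.2 ≤ a ∨ a + 1 / 2 ≤ x.2) :
    IsIsotopic R (D ∪ (fun x => (x.1, x.2 / 2 + a)) '' C)
      (D ∪ (fun x => (x.1, x.2 / 2 + a)) '' C') := by
  obtain ⟨Φ, Ψ, hΦ, hΨ, h1, h2, h0, hR, hw, ⟨ε, hε, he⟩, hC⟩ := h
  let A : Space → Space := fun x => (x.1, x.2 / 2 + a)
  let A' : Space → Space := fun x => (x.1, 2 * (x.2 - a))
  have hAA : ∀ x, A (A' x) = x := fun x => Prod.ext rfl (by simp only [A, A']; ring)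
  have hAA' : ∀ x, A' (A x) = x := fun x => Prod.ext rfl (by simp only [A, A']; ring)
  have hA : ContDiff ℝ ∞ A := by fun_prop
  have hA' : ContDiff ℝ ∞ A' := by fun_prop
  have hid : ∀ t x, x.2 ≤ a + ε / 2 ∨ a + 1 / 2 - ε / 2 ≤ x.2 → A (Φ (t, A' x)) = x := by
    intro t x hx
    rw [he t (A' x) (hx.imp (fun h => by simp only [A']; linarith)
      fun h => by simp only [A']; linarith), hAA]
  have conj : ∀ Θ : ℝ × Space → Space, ContDiff ℝ ∞ Θ →
      ContDiff ℝ ∞ fun y : ℝ × Space => A (Θ (y.1, A' y.2)) := fun Θ hΘ =>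
    hA.comp (hΘ.comp (contDiff_fst.prodMk (hA'.comp contDiff_snd)))
  refine ⟨fun y => A (Φ (y.1, A' y.2)), fun y => A (Ψ (y.1, A' y.2)), conj Φ hΦ, conj Ψ hΨ,
    fun t x => ?_, fun t x => ?_, fun x => ?_, fun t x => ?_, fun q hq t x => ?_,
    ⟨ε / 2, half_pos hε, fun t x hx => ?_⟩, ?_⟩
  · simp only [hAA', h1, hAA]
  · simp only [hAA', h2, hAA]
  · simp only [h0, hAA]
  · exact hR t (A' x)
  · exact hw q hq t (A' x)
  · exact hid t x (hx.imp (fun h => by linarith) fun h => by linarith)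
  · rw [image_union, image_image]
    congr 1
    · conv_rhs => rw [← image_id' D]
      refine image_congr fun x hx => ?_
      exact hid 1 x ((hD x hx).imp (fun h => by linarith) fun h => by linarith)
    · rw [← hC, image_image]
      refine image_congr fun x _ => ?_
      have : A' (x.1, x.2 / 2 + a) = x := hAA' x
      simp only [this]
      rfl

/-- Vertical curves give vertical surfaces. -/
theorem CurveAt.surfaceAt {R : Region} {γ : Set Plane} {C : Set Space} {x : Space}
    (h : CurveAt R γ x.1) {V : Set Space} (hV : IsOpen V) (hx : x ∈ V)
    (hC : ∀ y ∈ V, y ∈ C ↔ y.2 ∈ Icc (0 : ℝ) 1 ∧ y.1 ∈ γ) : SurfaceAt R C x := by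
  obtain ⟨U, hU, hxU, f, hf, hd, hb, hγ⟩ := h
  have hfx : DifferentiableAt ℝ f x.1 :=
    (hf.contDiffAt (hU.mem_nhds hxU)).differentiableAt (by simp)
  have key : fderiv ℝ (fun y : Space => f y.1) x =
      (fderiv ℝ f x.1).comp (ContinuousLinearMap.fst ℝ Plane ℝ) :=
    (hfx.hasFDerivAt.comp x hasFDerivAt_fst).fderiv
  refine ⟨V ∩ Prod.fst ⁻¹' U, hV.inter (hU.preimage continuous_fst), ⟨hx, hxU⟩,
    fun y => f y.1, hf.comp contDiff_fst.contDiffOn fun y hy => hy.2, ?_, ?_, ?_⟩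
  · rw [key]
    intro h0
    apply hd
    ext1 <;> · ext1; simpa using DFunLike.congr_fun h0 ((_, _), (0 : ℝ))
  · intro hxb
    rw [key]
    exact hb hxb
  · intro y hy
    rw [hC y hy.1, hγ y.1 hy.2]
    tauto

/-- Rescaling a surface vertically. -/
theorem SurfaceAt.rescale {R : Region} {C C' : Set Space} {x : Space} {m c : ℝ} (hm : m ≠ 0)
    (h : SurfaceAt R C (x.1, m * x.2 + c)) {V : Set Space} (hV : IsOpen V) (hx : x ∈ V)
    (hI : ∀ y ∈ V, y.2 ∈ Icc (0 : ℝ) 1 ↔ m * y.2 + c ∈ Icc (0 : ℝ) 1)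
    (hC : ∀ y ∈ V, y ∈ C' ↔ (y.1, m * y.2 + c) ∈ C) : SurfaceAt R C' x := by
  obtain ⟨U, hU, hxU, f, hf, hd, hb, hγ⟩ := h
  let A : Space → Space := fun y => (y.1, m * y.2 + c)
  have hA : ContDiff ℝ ∞ A := by fun_prop
  let L : Space →L[ℝ] Space := (ContinuousLinearMap.fst ℝ Plane ℝ).prod
    (m • ContinuousLinearMap.snd ℝ Plane ℝ)
  have hAL : HasFDerivAt A L x :=
    hasFDerivAt_fst.prodMk ((hasFDerivAt_snd.const_mul m).add_const c)
  have hfx : DifferentiableAt ℝ f (A x) :=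
    (hf.contDiffAt (hU.mem_nhds hxU)).differentiableAt (by simp)
  have key : fderiv ℝ (fun y : Space => f (A y)) x = (fderiv ℝ f (A x)).comp L :=
    (hfx.hasFDerivAt.comp x hAL).fderiv
  refine ⟨V ∩ A ⁻¹' U, hV.inter (hU.preimage hA.continuous), ⟨hx, hxU⟩,
    fun y => f (A y), hf.comp hA.contDiffOn fun y hy => hy.2, ?_, ?_, ?_⟩
  · rw [key]
    intro h0
    apply hd
    refine ContinuousLinearMap.ext fun v => ?_
    have hv : L (v.1, m⁻¹ * v.2) = v := by
      refine Prod.ext rfl ?_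
      change m * (m⁻¹ * v.2) = v.2
      field_simp
    have := DFunLike.congr_fun h0 (v.1, m⁻¹ * v.2)
    rw [ContinuousLinearMap.comp_apply, hv] at this
    exact this
  · intro hxb
    rw [key, ContinuousLinearMap.comp_apply]
    have hv : L ((-x.1.2, x.1.1), 0) = ((-x.1.2, x.1.1), 0) := by
      refine Prod.ext rfl ?_
      change m * 0 = 0
      simp
    rw [hv]
    exact hb hxb
  · intro y hy
    rw [hC y hy.1, hI y hy.1]
    exact hγ (A y) hy.2

/-- Placing `C` atop `C'`: the set `C`, shrunk to the heights `[1/2, 1]`, together with `C'`, shrunk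
to the heights `[0, 1/2]`. -/
def stack (C C' : Set Space) : Set Space :=
  (fun x => (x.1, x.2 / 2 + 1 / 2)) '' C ∪ (fun x => (x.1, x.2 / 2 + 0)) '' C'

theorem mem_stack {C C' : Set Space} {p : Plane} {z : ℝ} :
    (p, z) ∈ stack C C' ↔ (p, 2 * z - 1) ∈ C ∨ (p, 2 * z) ∈ C' := by
  constructor
  · rintro (⟨⟨q, w⟩, hx, he⟩ | ⟨⟨q, w⟩, hx, he⟩)
    · obtain ⟨rfl, rfl⟩ := Prod.mk.inj he
      left
      convert hx using 2
      simp only; ring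
    · obtain ⟨rfl, rfl⟩ := Prod.mk.inj he
      right
      convert hx using 2
      simp only; ring
  · rintro (h | h)
    · exact Or.inl ⟨_, h, Prod.ext rfl (by simp only; ring)⟩
    · exact Or.inr ⟨_, h, Prod.ext rfl (by simp only; ring)⟩

namespace EmbeddedCobordism

variable {R : Region} {B : Finset Plane} {γ γ' γ'' : Smoothing R B}

theorem mem_height (C : EmbeddedCobordism γ γ') {p : Plane} {z : ℝ} (h : (p, z) ∈ C.carrier) :
    0 ≤ z ∧ z ≤ 1 := (C.subset _ h).2

theorem mem_top (C : EmbeddedCobordism γ γ') (p : Plane) :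
    (p, (1 : ℝ)) ∈ C.carrier ↔ p ∈ γ.carrier := by
  obtain ⟨ε, hε, -, h⟩ := C.top
  exact h p 1 (by linarith) le_rfl

theorem mem_bottom (C : EmbeddedCobordism γ γ') (p : Plane) :
    (p, (0 : ℝ)) ∈ C.carrier ↔ p ∈ γ'.carrier := by
  obtain ⟨ε, hε, -, h⟩ := C.bottom
  exact h p 0 le_rfl hε.le

theorem mem_stack_upper (C : EmbeddedCobordism γ γ') (C' : EmbeddedCobordism γ' γ'')
    {p : Plane} {z : ℝ} (hz : 1 / 2 ≤ z) :
    (p, z) ∈ stack C.carrier C'.carrier ↔ (p, 2 * z - 1) ∈ C.carrier := by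
  rw [mem_stack]
  refine ⟨fun h => h.elim id fun h => ?_, Or.inl⟩
  have h1 : z = 1 / 2 := by have := (C'.mem_height h).2; linarith
  subst h1
  norm_num at h ⊢
  rwa [mem_bottom, ← mem_top C']

theorem mem_stack_lower (C : EmbeddedCobordism γ γ') (C' : EmbeddedCobordism γ' γ'')
    {p : Plane} {z : ℝ} (hz : z ≤ 1 / 2) :
    (p, z) ∈ stack C.carrier C'.carrier ↔ (p, 2 * z) ∈ C'.carrier := by
  rw [mem_stack]
  refine ⟨fun h => h.elim (fun h => ?_) id, Or.inr⟩
  have h1 : z = 1 / 2 := by have := (C.mem_height h).1; linarith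
  subst h1
  norm_num at h ⊢
  rwa [mem_top, ← mem_bottom C]

/-- The identity cobordism `γ × [0, 1]`. -/
def id (γ : Smoothing R B) : EmbeddedCobordism γ γ where
  carrier := γ.carrier ×ˢ Icc (0 : ℝ) 1
  isCompact := γ.isCompact.prod isCompact_Icc
  subset x hx := ⟨γ.subset hx.1, hx.2⟩
  surfaceAt x hx := (γ.curveAt x.1 hx.1).surfaceAt isOpen_univ (mem_univ x)
    fun y _ => And.comm
  wall p hp z hz := by
    rw [← γ.boundary p hp]
    exact ⟨fun h => h.1, fun h => ⟨h, hz⟩⟩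
  top := ⟨1 / 2, by norm_num, by norm_num, fun p z h1 h2 =>
    ⟨fun h => h.1, fun h => ⟨h, by linarith, h2⟩⟩⟩
  bottom := ⟨1 / 2, by norm_num, by norm_num, fun p z h1 h2 =>
    ⟨fun h => h.1, fun h => ⟨h, h1, by linarith⟩⟩⟩

/-- Composition: placing `C` atop `C'`. -/
def comp (C : EmbeddedCobordism γ γ') (C' : EmbeddedCobordism γ' γ'') :
    EmbeddedCobordism γ γ'' where
  carrier := stack C.carrier C'.carrier
  isCompact := (C.isCompact.image (by fun_prop)).union (C'.isCompact.image (by fun_prop))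
  subset := by
    rintro ⟨p, z⟩ hx
    rcases mem_stack.1 hx with h | h
    · have h1 := C.subset _ h
      exact ⟨h1.1, by have := h1.2.1; simp only at *; linarith,
        by have := h1.2.2; simp only at *; linarith⟩
    · have h1 := C'.subset _ h
      exact ⟨h1.1, by have := h1.2.1; simp only at *; linarith,
        by have := h1.2.2; simp only at *; linarith⟩
  surfaceAt := by
    rintro ⟨p, z⟩ hx
    rcases lt_trichotomy z (1 / 2) with hz | hz | hz
    · have h1 := (mem_stack_lower C C' hz.le).1 hx
      refine SurfaceAt.rescale (m := 2) (c := 0) two_ne_zero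
        (by simpa using C'.surfaceAt _ h1) (V := {y | y.2 < 1 / 2})
        (isOpen_lt (by fun_prop) (by fun_prop)) hz (fun y hy => ?_) fun y hy => ?_
      · simp only [mem_ofPred_eq, mem_Icc] at *
        constructor <;> rintro ⟨h1, h2⟩ <;> constructor <;> linarith
      · rw [add_zero]
        exact mem_stack_lower C C' (le_of_lt hy)
    · subst hz
      obtain ⟨ε, hε, -, h1⟩ := C.bottom
      obtain ⟨ε', hε', -, h2⟩ := C'.top
      have h3 := (mem_stack_lower C C' le_rfl).1 hx
      norm_num at h3
      rw [mem_top] at h3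
      refine CurveAt.surfaceAt (γ'.curveAt p h3)
        (V := {y | y.2 < 1 / 2 + min ε (1 / 2) / 2} ∩ {y | 1 / 2 - min ε' (1 / 2) / 2 < y.2})
        ((isOpen_lt (by fun_prop) (by fun_prop)).inter (isOpen_lt (by fun_prop) (by fun_prop)))
        ⟨?_, ?_⟩ ?_
      · simp only [mem_ofPred_eq]
        have := lt_min hε (by norm_num : (0 : ℝ) < 1 / 2)
        linarith
      · simp only [mem_ofPred_eq]
        have := lt_min hε' (by norm_num : (0 : ℝ) < 1 / 2)
        linarith
      · rintro ⟨q, w⟩ ⟨hw1, hw2⟩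
        simp only [mem_ofPred_eq] at hw1 hw2
        have b1 := min_le_left ε (1 / 2)
        have b2 := min_le_right ε (1 / 2)
        have b3 := min_le_left ε' (1 / 2)
        have b4 := min_le_right ε' (1 / 2)
        have hI : w ∈ Icc (0 : ℝ) 1 := ⟨by linarith, by linarith⟩
        rcases le_total w (1 / 2) with hw | hw
        · rw [mem_stack_lower C C' hw, h2 q _ (by linarith) (by linarith)]
          simp only [hI, true_and]
        · rw [mem_stack_upper C C' hw, h1 q _ (by linarith) (by linarith)]
          simp only [hI, true_and]
    · have h1 := (mem_stack_upper C C' hz.le).1 hx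
      refine SurfaceAt.rescale (m := 2) (c := -1) two_ne_zero
        (by simpa [sub_eq_add_neg] using C.surfaceAt _ h1) (V := {y | 1 / 2 < y.2})
        (isOpen_lt (by fun_prop) (by fun_prop)) hz (fun y hy => ?_) fun y hy => ?_
      · simp only [mem_ofPred_eq, mem_Icc] at *
        constructor <;> rintro ⟨h1, h2⟩ <;> constructor <;> linarith
      · rw [← sub_eq_add_neg]
        exact mem_stack_upper C C' (le_of_lt hy)
  wall p hp z hz := by
    rcases le_total z (1 / 2) with h | h
    · rw [mem_stack_lower C C' h]
      exact C'.wall p hp _ ⟨by linarith [hz.1], by linarith⟩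
    · rw [mem_stack_upper C C' h]
      exact C.wall p hp _ ⟨by linarith, by linarith [hz.2]⟩
  top := by
    obtain ⟨ε, hε, hε1, h⟩ := C.top
    refine ⟨ε / 2, half_pos hε, by linarith, fun p z h1 h2 => ?_⟩
    rw [mem_stack_upper C C' (by linarith)]
    exact h p _ (by linarith) (by linarith)
  bottom := by
    obtain ⟨ε, hε, hε1, h⟩ := C'.bottom
    refine ⟨ε / 2, half_pos hε, by linarith, fun p z h1 h2 => ?_⟩
    rw [mem_stack_lower C C' (by linarith)]
    exact h p _ (by linarith) (by linarith)

theorem stack_congr {C D : EmbeddedCobordism γ γ'} {C' D' : EmbeddedCobordism γ' γ''}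
    (h : IsIsotopic R C.carrier D.carrier) (h' : IsIsotopic R C'.carrier D'.carrier) :
    IsIsotopic R (C.comp C').carrier (D.comp D').carrier := by
  have h1 : IsIsotopic R (stack C.carrier C'.carrier) (stack C.carrier D'.carrier) := by
    refine h'.stack le_rfl (by norm_num) ?_
    rintro _ ⟨⟨p, z⟩, hx, rfl⟩
    have := (C.mem_height hx).1
    right; simp only; linarith
  have h2 : IsIsotopic R (stack C.carrier D'.carrier) (stack D.carrier D'.carrier) := by
    unfold stack
    rw [union_comm, union_comm _ ((fun x : Space => (x.1, x.2 / 2 + 0)) '' D'.carrier)]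
    refine h.stack (by norm_num) le_rfl ?_
    rintro _ ⟨⟨p, z⟩, hx, rfl⟩
    have := (D'.mem_height hx).2
    left; simp only; linarith
  exact h1.trans h2

/-- A common collar width for a cobordism. -/
theorem exists_collar (C : EmbeddedCobordism γ γ') : ∃ ε > 0, ε < 1 / 4 ∧
    (∀ p z, 1 - ε ≤ z → z ≤ 1 → ((p, z) ∈ C.carrier ↔ p ∈ γ.carrier)) ∧
    ∀ p z, 0 ≤ z → z ≤ ε → ((p, z) ∈ C.carrier ↔ p ∈ γ'.carrier) := by
  obtain ⟨ε, hε, -, h⟩ := C.top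
  obtain ⟨ε', hε', -, h'⟩ := C.bottom
  have a1 := min_le_left (min ε ε') (1 / 8)
  have a2 := min_le_right (min ε ε') (1 / 8)
  have a3 := min_le_left ε ε'
  have a4 := min_le_right ε ε'
  exact ⟨min (min ε ε') (1 / 8), lt_min (lt_min hε hε') (by norm_num), by linarith,
    fun p z h1 h2 => h p z (by linarith) h2, fun p z h1 h2 => h' p z h1 (by linarith)⟩

theorem isIsotopic_of_repar {C C' : Set Space} {h : ℝ → ℝ} (hh : IsRepar h)
    {ε : ℝ} (hε : 0 < ε) (hid : ∀ z, z ≤ ε ∨ 1 - ε ≤ z → h z = z)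
    (hC : ∀ p z, (p, z) ∈ C ↔ (p, h z) ∈ C') : IsIsotopic R C C' :=
  isIsotopic_of_vertical (fun x => h x.2) (hh.1.comp contDiff_snd) (fun _ z => hh.2 z) hε
    (fun _ z hz => hid z hz) hC

/-- A reparametrization which is affine on a given interval and the identity near the ends. -/
theorem exists_repar_affine {ε m c : ℝ} (hε : 0 < ε) (hε' : ε < 1 / 4) (hm : 0 < m)
    (h0 : 0 ≤ c) (h1 : m + c ≤ 1) : ∃ h, IsRepar h ∧
      (∀ z, z ≤ m * ε / 2 ∨ 1 - m * ε / 2 ≤ z → h z = z) ∧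
      ∀ z, ε ≤ z → z ≤ 1 - ε → h z = m * z + c := by
  have hm1 : m ≤ 1 := by linarith
  have hme : m * ε ≤ ε := by nlinarith
  have hme0 : 0 < m * ε := mul_pos hm hε
  obtain ⟨j, hj, j1, j2⟩ := exists_join (a := m * ε / 2) (b := ε) (A := m * ε / 2)
    (B := m * ε + c) (m := 1) (n := m) (by linarith) (by linarith) one_pos hm
  obtain ⟨k, hk, k1, k2⟩ := exists_join (a := 1 - ε) (b := 1 - m * ε / 2) (A := m * (1 - ε) + c)
    (B := 1 - m * ε / 2) (m := m) (n := 1) (by linarith) (by nlinarith) hm one_pos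
  refine ⟨_, hj.glue hk (a := ε) (b := 1 - ε) (c := 1 / 2) (by linarith) (by linarith)
    fun z h1 h2 => ?_, ?_, ?_⟩
  · rw [j2 z h1, k1 z h2]; ring
  · rintro z (hz | hz)
    · rw [if_pos (by linarith), j1 z hz]; ring
    · rw [if_neg (by linarith), k2 z hz]; ring
  · intro z h1 h2
    split_ifs
    · rw [j2 z h1]; ring
    · rw [k1 z h2]; ring

theorem id_comp_isotopic (C : EmbeddedCobordism γ γ') :
    IsIsotopic R ((EmbeddedCobordism.id γ).comp C).carrier C.carrier := by
  obtain ⟨ε, hε, hε', ht, hb⟩ := C.exists_collar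
  obtain ⟨h, hh, h1, h2⟩ := exists_repar_affine (m := 1 / 2) (c := 0) hε hε' (by norm_num)
    le_rfl (by norm_num)
  refine (isIsotopic_of_repar hh (ε := 1 / 2 * ε / 2) (by linarith) h1 fun p z => ?_).symm
  have mono := hh.strictMono
  have v1 := h2 ε le_rfl (by linarith)
  have v2 := h2 (1 - ε) (by linarith) le_rfl
  have w0 : h 0 = 0 := h1 0 (Or.inl (by linarith))
  have w1 : h 1 = 1 := h1 1 (Or.inr (by linarith))
  change _ ↔ (p, h z) ∈ stack _ _
  rcases lt_or_ge z 0 with hz | hz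
  · have := mono hz
    exact iff_of_false (fun h => by linarith [(C.mem_height h).1])
      fun h => by linarith [(mem_height (comp (EmbeddedCobordism.id γ) C) h).1]
  rcases lt_or_ge 1 z with hz' | hz'
  · have := mono hz'
    exact iff_of_false (fun h => by linarith [(C.mem_height h).2])
      fun h => by linarith [(mem_height (comp (EmbeddedCobordism.id γ) C) h).2]
  have m0 := mono.monotone hz
  have m1 := mono.monotone hz'
  rcases le_total z ε with z1 | z1
  · have m2 := mono.monotone z1
    rw [mem_stack_lower (EmbeddedCobordism.id γ) C (by linarith), hb p z hz z1,
      hb p _ (by linarith) (by linarith)]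
  rcases le_total z (1 - ε) with z2 | z2
  · rw [h2 z z1 z2, mem_stack_lower (EmbeddedCobordism.id γ) C (by linarith)]
    rw [show 2 * (1 / 2 * z + 0) = z by ring]
  · have m2 := mono.monotone z2
    rw [ht p z z2 hz']
    rcases le_total (h z) (1 / 2) with z3 | z3
    · rw [mem_stack_lower (EmbeddedCobordism.id γ) C z3, ht p _ (by linarith) (by linarith)]
    · rw [mem_stack_upper (EmbeddedCobordism.id γ) C z3]
      exact ⟨fun h => ⟨h, by simp only; linarith, by simp only; linarith⟩, fun h => h.1⟩

theorem comp_id_isotopic (C : EmbeddedCobordism γ γ') :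
    IsIsotopic R (C.comp (EmbeddedCobordism.id γ')).carrier C.carrier := by
  obtain ⟨ε, hε, hε', ht, hb⟩ := C.exists_collar
  obtain ⟨h, hh, h1, h2⟩ := exists_repar_affine (m := 1 / 2) (c := 1 / 2) hε hε' (by norm_num)
    (by norm_num) (by norm_num)
  refine (isIsotopic_of_repar hh (ε := 1 / 2 * ε / 2) (by linarith) h1 fun p z => ?_).symm
  have mono := hh.strictMono
  have v1 := h2 ε le_rfl (by linarith)
  have v2 := h2 (1 - ε) (by linarith) le_rfl
  have w0 : h 0 = 0 := h1 0 (Or.inl (by linarith))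
  have w1 : h 1 = 1 := h1 1 (Or.inr (by linarith))
  change _ ↔ (p, h z) ∈ stack _ _
  rcases lt_or_ge z 0 with hz | hz
  · have := mono hz
    exact iff_of_false (fun h => by linarith [(C.mem_height h).1])
      fun h => by linarith [(mem_height (comp C (EmbeddedCobordism.id γ')) h).1]
  rcases lt_or_ge 1 z with hz' | hz'
  · have := mono hz'
    exact iff_of_false (fun h => by linarith [(C.mem_height h).2])
      fun h => by linarith [(mem_height (comp C (EmbeddedCobordism.id γ')) h).2]
  have m0 := mono.monotone hz
  have m1 := mono.monotone hz'
  rcases le_total (1 - ε) z with z1 | z1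
  · have m2 := mono.monotone z1
    rw [mem_stack_upper C (EmbeddedCobordism.id γ') (by linarith), ht p z z1 hz',
      ht p _ (by linarith) (by linarith)]
  rcases le_total ε z with z2 | z2
  · rw [h2 z z2 z1, mem_stack_upper C (EmbeddedCobordism.id γ') (by linarith)]
    rw [show 2 * (1 / 2 * z + 1 / 2) - 1 = z by ring]
  · have m2 := mono.monotone z2
    rw [hb p z hz z2]
    rcases le_total (1 / 2) (h z) with z3 | z3
    · rw [mem_stack_upper C (EmbeddedCobordism.id γ') z3, hb p _ (by linarith) (by linarith)]
    · rw [mem_stack_lower C (EmbeddedCobordism.id γ') z3]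
      exact ⟨fun h => ⟨h, by simp only; linarith, by simp only; linarith⟩, fun h => h.1⟩

/-- A reparametrization taking the heights `[0, 1/2]`, `[1/2, 3/4]`, `[3/4, 1]` to the heights
`[0, 1/4]`, `[1/4, 1/2]`, `[1/2, 1]`. -/
theorem exists_repar_assoc {ε : ℝ} (hε : 0 < ε) (hε' : ε < 1 / 4) : ∃ h, IsRepar h ∧
      (∀ z, z ≤ ε / 16 ∨ 1 - ε / 16 ≤ z → h z = z) ∧
      (∀ z, ε / 2 ≤ z → z ≤ 1 / 2 - ε / 2 → h z = z / 2) ∧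
      (∀ z, 1 / 2 + ε / 4 ≤ z → z ≤ 3 / 4 - ε / 4 → h z = z - 1 / 4) ∧
      (∀ z, 3 / 4 + ε / 4 ≤ z → z ≤ 1 - ε / 4 → h z = 2 * z - 1) := by
  obtain ⟨j, hj, j1, j2⟩ := exists_join (a := ε / 16) (b := ε / 2) (A := ε / 16)
    (B := ε / 4) (m := 1) (n := 1 / 2) (by linarith) (by linarith) one_pos (by norm_num)
  obtain ⟨k, hk, k1, k2⟩ := exists_join (a := 1 / 2 - ε / 2) (b := 1 / 2 + ε / 4)
    (A := 1 / 4 - ε / 4) (B := 1 / 4 + ε / 4) (m := 1 / 2) (n := 1) (by linarith) (by linarith)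
    (by norm_num) one_pos
  obtain ⟨l, hl, l1, l2⟩ := exists_join (a := 3 / 4 - ε / 4) (b := 3 / 4 + ε / 4)
    (A := 1 / 2 - ε / 4) (B := 1 / 2 + ε / 2) (m := 1) (n := 2) (by linarith) (by linarith)
    one_pos two_pos
  obtain ⟨n, hn, n1, n2⟩ := exists_join (a := 1 - ε / 4) (b := 1 - ε / 16)
    (A := 1 - ε / 2) (B := 1 - ε / 16) (m := 2) (n := 1) (by linarith) (by linarith)
    two_pos one_pos
  have g1 := hj.glue hk (a := ε / 2) (b := 1 / 2 - ε / 2) (c := 1 / 4) (by linarith) (by linarith)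
    fun z h1 h2 => by rw [j2 z h1, k1 z h2]; ring
  have g2 := hl.glue hn (a := 3 / 4 + ε / 4) (b := 1 - ε / 4) (c := 7 / 8) (by linarith)
    (by linarith) fun z h1 h2 => by rw [l2 z h1, n1 z h2]; ring
  have g3 := g1.glue g2 (a := 1 / 2 + ε / 4) (b := 3 / 4 - ε / 4) (c := 5 / 8) (by linarith)
    (by linarith) fun z h1 h2 => by
      rw [if_neg (by linarith), if_pos (by linarith), k2 z h1, l1 z h2]; ring
  refine ⟨_, g3, ?_, fun z h1 h2 => ?_, fun z h1 h2 => ?_, fun z h1 h2 => ?_⟩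
  · rintro z (hz | hz)
    · rw [if_pos (by linarith), if_pos (by linarith), j1 z hz]; ring
    · rw [if_neg (by linarith), if_neg (by linarith), n2 z hz]; ring
  · rw [if_pos (by linarith)]
    split_ifs
    · rw [j2 z h1]; ring
    · rw [k1 z h2]; ring
  · split_ifs
    · linarith
    · rw [k2 z h1]; ring
    · rw [l1 z h2]; ring
    · linarith
  · rw [if_neg (by linarith)]
    split_ifs
    · rw [l2 z h1]; ring
    · rw [n1 z h2]; ring

theorem assoc_isotopic {γ''' : Smoothing R B} (C : EmbeddedCobordism γ γ')
    (C' : EmbeddedCobordism γ' γ'') (C'' : EmbeddedCobordism γ'' γ''') :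
    IsIsotopic R ((C.comp C').comp C'').carrier (C.comp (C'.comp C'')).carrier := by
  obtain ⟨ε₁, hε₁, hε₁', ht₁, hb₁⟩ := C.exists_collar
  obtain ⟨ε₂, hε₂, hε₂', ht₂, hb₂⟩ := C'.exists_collar
  obtain ⟨ε₃, hε₃, hε₃', ht₃, hb₃⟩ := C''.exists_collar
  obtain ⟨ε, hε, e1, e2, e3⟩ : ∃ ε > 0, ε ≤ ε₁ ∧ ε ≤ ε₂ ∧ ε ≤ ε₃ :=
    ⟨min ε₁ (min ε₂ ε₃), lt_min hε₁ (lt_min hε₂ hε₃), min_le_left _ _,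
      (min_le_right _ _).trans (min_le_left _ _), (min_le_right _ _).trans (min_le_right _ _)⟩
  obtain ⟨h, hh, h1, h2, h3, h4⟩ := exists_repar_assoc hε (by linarith)
  refine isIsotopic_of_repar hh (ε := ε / 16) (by linarith) h1 fun p z => ?_
  have mono := hh.strictMono
  have u1 := h2 (ε / 2) le_rfl (by linarith)
  have u2 := h2 (1 / 2 - ε / 2) (by linarith) le_rfl
  have u3 := h3 (1 / 2 + ε / 4) le_rfl (by linarith)
  have u4 := h3 (3 / 4 - ε / 4) (by linarith) le_rfl
  have u5 := h4 (3 / 4 + ε / 4) le_rfl (by linarith)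
  have u6 := h4 (1 - ε / 4) (by linarith) le_rfl
  have w0 : h 0 = 0 := h1 0 (Or.inl (by linarith))
  have w1 : h 1 = 1 := h1 1 (Or.inr (by linarith))
  rcases lt_or_ge z 0 with hz | hz
  · have := mono hz
    exact iff_of_false (fun h => by linarith [(mem_height _ h).1])
      fun h => by linarith [(mem_height _ h).1]
  rcases lt_or_ge 1 z with hz' | hz'
  · have := mono hz'
    exact iff_of_false (fun h => by linarith [(mem_height _ h).2])
      fun h => by linarith [(mem_height _ h).2]
  have m0 := mono.monotone hz
  have m1 := mono.monotone hz'
  have L3 : ∀ w, w ≤ 1 / 2 →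
      ((p, w) ∈ ((C.comp C').comp C'').carrier ↔ (p, 2 * w) ∈ C''.carrier) :=
    fun w hw => mem_stack_lower (C.comp C') C'' hw
  have L2 : ∀ w, 1 / 2 ≤ w → w ≤ 3 / 4 →
      ((p, w) ∈ ((C.comp C').comp C'').carrier ↔ (p, 2 * (2 * w - 1)) ∈ C'.carrier) :=
    fun w hw hw' => (mem_stack_upper (C.comp C') C'' hw).trans
      (mem_stack_lower C C' (by linarith))
  have L1 : ∀ w, 3 / 4 ≤ w →
      ((p, w) ∈ ((C.comp C').comp C'').carrier ↔ (p, 2 * (2 * w - 1) - 1) ∈ C.carrier) :=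
    fun w hw => (mem_stack_upper (C.comp C') C'' (by linarith)).trans
      (mem_stack_upper C C' (by linarith))
  have R1 : ∀ w, 1 / 2 ≤ w →
      ((p, w) ∈ (C.comp (C'.comp C'')).carrier ↔ (p, 2 * w - 1) ∈ C.carrier) :=
    fun w hw => mem_stack_upper C (C'.comp C'') hw
  have R2 : ∀ w, 1 / 4 ≤ w → w ≤ 1 / 2 →
      ((p, w) ∈ (C.comp (C'.comp C'')).carrier ↔ (p, 2 * (2 * w) - 1) ∈ C'.carrier) :=
    fun w hw hw' => (mem_stack_lower C (C'.comp C'') hw').trans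
      (mem_stack_upper C' C'' (by linarith))
  have R3 : ∀ w, w ≤ 1 / 4 →
      ((p, w) ∈ (C.comp (C'.comp C'')).carrier ↔ (p, 2 * (2 * w)) ∈ C''.carrier) :=
    fun w hw => (mem_stack_lower C (C'.comp C'') (by linarith)).trans
      (mem_stack_lower C' C'' (by linarith))
  rcases le_total z (ε / 2) with z1 | z1
  · have m2 := mono.monotone z1
    rw [L3 z (by linarith), R3 _ (by linarith), hb₃ p _ (by linarith) (by linarith),
      hb₃ p _ (by linarith) (by linarith)]
  rcases le_total z (1 / 2 - ε / 2) with z2 | z2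
  · rw [L3 z (by linarith), h2 z z1 z2, R3 _ (by linarith),
      show 2 * (2 * (z / 2)) = 2 * z by ring]
  rcases le_total z (1 / 2 + ε / 4) with z3 | z3
  · have m2 := mono.monotone z2
    have m3 := mono.monotone z3
    have l : (p, z) ∈ ((C.comp C').comp C'').carrier ↔ p ∈ γ''.carrier := by
      rcases le_total z (1 / 2) with c | c
      · rw [L3 z c, ht₃ p _ (by linarith) (by linarith)]
      · rw [L2 z c (by linarith), hb₂ p _ (by linarith) (by linarith)]
    rw [l]
    rcases le_total (h z) (1 / 4) with c | c
    · rw [R3 _ c, ht₃ p _ (by linarith) (by linarith)]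
    · rw [R2 _ c (by linarith), hb₂ p _ (by linarith) (by linarith)]
  rcases le_total z (3 / 4 - ε / 4) with z4 | z4
  · rw [L2 z (by linarith) (by linarith), h3 z z3 z4, R2 _ (by linarith) (by linarith),
      show 2 * (2 * (z - 1 / 4)) - 1 = 2 * (2 * z - 1) by ring]
  rcases le_total z (3 / 4 + ε / 4) with z5 | z5
  · have m2 := mono.monotone z4
    have m3 := mono.monotone z5
    have l : (p, z) ∈ ((C.comp C').comp C'').carrier ↔ p ∈ γ'.carrier := by
      rcases le_total z (3 / 4) with c | c
      · rw [L2 z (by linarith) c, ht₂ p _ (by linarith) (by linarith)]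
      · rw [L1 z c, hb₁ p _ (by linarith) (by linarith)]
    rw [l]
    rcases le_total (h z) (1 / 2) with c | c
    · rw [R2 _ (by linarith) c, ht₂ p _ (by linarith) (by linarith)]
    · rw [R1 _ c, hb₁ p _ (by linarith) (by linarith)]
  rcases le_total z (1 - ε / 4) with z6 | z6
  · rw [L1 z (by linarith), h4 z z5 z6, R1 _ (by linarith)]
  · have m2 := mono.monotone z6
    rw [L1 z (by linarith), R1 _ (by linarith), ht₁ p _ (by linarith) (by linarith),
      ht₁ p _ (by linarith) (by linarith)]

/-- Cobordisms up to boundary-preserving isotopy. -/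
instance setoid (γ γ' : Smoothing R B) : Setoid (EmbeddedCobordism γ γ') where
  r C C' := IsIsotopic R C.carrier C'.carrier
  iseqv := ⟨fun _ => IsIsotopic.refl _ _, IsIsotopic.symm, IsIsotopic.trans⟩

end EmbeddedCobordism

/-- The category `Cob³(B)`: its objects are the smoothings with boundary `B`, its morphisms are the
embedded cobordisms up to boundary-preserving isotopy, and composition places one cobordism atop
the other. -/
instance cobCategory (R : Region) (B : Finset Plane) : Category (Smoothing R B) where
  Hom γ γ' := Quotient (EmbeddedCobordism.setoid γ γ')
  id γ := Quotient.mk _ (EmbeddedCobordism.id γ)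
  comp := Quotient.map₂ EmbeddedCobordism.comp
    fun _ _ h _ _ h' => EmbeddedCobordism.stack_congr h h'
  id_comp := by
    rintro γ γ' ⟨C⟩
    exact Quotient.sound (EmbeddedCobordism.id_comp_isotopic C)
  comp_id := by
    rintro γ γ' ⟨C⟩
    exact Quotient.sound (EmbeddedCobordism.comp_id_isotopic C)
  assoc := by
    rintro γ γ' γ'' γ''' ⟨C⟩ ⟨C'⟩ ⟨C''⟩
    exact Quotient.sound (EmbeddedCobordism.assoc_isotopic C C' C'')

/-- The pre-additive category of formal `ℤ`-linear combinations of morphisms of `Cob³(B)`. -/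
abbrev PreaddCob (R : Region) (B : Finset Plane) : Type := Free ℤ (Smoothing R B)

/-! ### Tangle diagrams -/

/-- `v` is a tangent vector at `p` to the smooth curve `γ`: it is annihilated by the differentials
of all smooth functions vanishing on `γ` near `p`. -/
def IsTangent (γ : Set Plane) (p v : Plane) : Prop :=
  ∀ U : Set Plane, IsOpen U → p ∈ U → ∀ f : Plane → ℝ, ContDiffOn ℝ ∞ f U →
    (∀ q ∈ U, q ∈ γ → f q = 0) → fderiv ℝ f p v = 0

/-- An oriented tangle diagram (a knot or link diagram if `B = ∅`) with ordered crossings. Away from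
its crossings it is a compact smooth curve in the region, meeting the boundary circle transversally,
exactly in `B`. Each crossing comes with a disk neighborhood, identified with the plane by an
orientation preserving diffeomorphism, in which the diagram is the union of the two coordinate axes:
the horizontal axis is the upper strand and the vertical axis is the lower strand. -/
structure TangleDiagram (R : Region) (B : Finset Plane) where
  carrier : Set Plane
  isCompact : IsCompact carrier
  subset : carrier ⊆ R.carrier
  boundary : ∀ p ∈ R.boundary, p ∈ carrier ↔ p ∈ B
  /-- the number of crossings -/
  n : ℕ
  chart : Fin n → OpenPartialHomeomorph Plane Plane
  chart_source : ∀ j, (chart j).source ⊆ R.carrier \ R.boundary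
  chart_target : ∀ j, (chart j).target = univ
  chart_contDiff : ∀ j, ContDiffOn ℝ ∞ (chart j) (chart j).source
  chart_symm_contDiff : ∀ j, ContDiff ℝ ∞ (chart j).symm
  chart_orientation : ∀ j, ∀ p ∈ (chart j).source, 0 < (fderiv ℝ (chart j) p).det
  chart_disjoint : ∀ i j, i ≠ j → Disjoint (chart i).source (chart j).source
  crossing : ∀ j, ∀ p ∈ (chart j).source, p ∈ carrier ↔ (chart j p).1 = 0 ∨ (chart j p).2 = 0
  curveAt : ∀ p ∈ carrier, (∀ j, p ≠ (chart j).symm 0) → CurveAt R carrier p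
  /-- the orientation: a direction at each point other than the crossings -/
  dir : Plane → Plane
  dir_continuous : ContinuousOn dir {p ∈ carrier | ∀ j, p ≠ (chart j).symm 0}
  dir_ne_zero : ∀ p ∈ carrier, (∀ j, p ≠ (chart j).symm 0) → dir p ≠ 0
  dir_tangent : ∀ p ∈ carrier, (∀ j, p ≠ (chart j).symm 0) → IsTangent carrier p (dir p)
  /-- whether the upper strand runs in the positive direction of the horizontal axis -/
  upper : Fin n → ℤˣ
  /-- whether the lower strand runs in the positive direction of the vertical axis -/
  lower : Fin n → ℤˣ
  dir_upper : ∀ j, ∀ p ∈ (chart j).source, (chart j p).2 = 0 → (chart j p).1 ≠ 0 →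
    0 < ((upper j : ℤ) : ℝ) * (fderiv ℝ (chart j) p (dir p)).1
  dir_lower : ∀ j, ∀ p ∈ (chart j).source, (chart j p).1 = 0 → (chart j p).2 ≠ 0 →
    0 < ((lower j : ℤ) : ℝ) * (fderiv ℝ (chart j) p (dir p)).2

/-- The zero set of `crossingFn (·, s)` is a resolution of the crossing of the two coordinate axes of the plane, with parameter
`s`. It agrees with the axes outside the disk of radius `√2`. For `s > 0` it joins, inside the disk,
the north strand to the east strand and the south strand to the west strand; for `s < 0` it joins
north to west and south to east. For `s = 0` it is the crossing itself. -/
def crossingFn (x : Space) : ℝ :=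
  x.1.1 * x.1.2 - x.2 * Real.smoothTransition (2 - (x.1.1 ^ 2 + x.1.2 ^ 2))

theorem crossingFn_contDiff : ContDiff ℝ ∞ crossingFn := by
  have : ContDiff ℝ ∞ fun x : Space =>
      Real.smoothTransition (2 - (x.1.1 ^ 2 + x.1.2 ^ 2)) :=
    Real.smoothTransition.contDiff.comp (by fun_prop)
  exact (by fun_prop : ContDiff ℝ ∞ fun x : Space => x.1.1 * x.1.2).sub
    (contDiff_snd.mul this)

theorem smoothTransition_hasDerivAt (x : ℝ) :
    HasDerivAt Real.smoothTransition (deriv Real.smoothTransition x) x :=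
  ((Real.smoothTransition.contDiff (n := 1)).differentiable (by simp) x).hasDerivAt

theorem fderiv_eq_of_line {f : Space → ℝ} (hf : ContDiff ℝ ∞ f) {x v : Space} {d : ℝ}
    (h : HasDerivAt (fun t : ℝ => f (x + t • v)) d 0) : fderiv ℝ f x v = d := by
  have h1 : DifferentiableAt ℝ f x := hf.differentiable (by simp) x
  have h2 : HasLineDerivAt ℝ f (fderiv ℝ f x v) x v := h1.hasFDerivAt.hasLineDerivAt v
  exact HasDerivAt.unique h2 h

theorem fderiv_crossingFn (u v s : ℝ) :
    fderiv ℝ crossingFn ((u, v), s) ((1, 0), 0) =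
      v + 2 * s * u * deriv Real.smoothTransition (2 - (u ^ 2 + v ^ 2)) ∧
    fderiv ℝ crossingFn ((u, v), s) ((0, 1), 0) =
      u + 2 * s * v * deriv Real.smoothTransition (2 - (u ^ 2 + v ^ 2)) ∧
    fderiv ℝ crossingFn ((u, v), s) ((0, 0), 1) =
      - Real.smoothTransition (2 - (u ^ 2 + v ^ 2)) := by
  refine ⟨fderiv_eq_of_line crossingFn_contDiff ?_, fderiv_eq_of_line crossingFn_contDiff ?_,
    fderiv_eq_of_line crossingFn_contDiff ?_⟩
  · have h1 : HasDerivAt (fun t : ℝ => u + t) 1 0 := (hasDerivAt_id (0 : ℝ)).const_add u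
    have h2 := ((h1.pow 2).add_const (v ^ 2)).const_sub 2
    have h3 := smoothTransition_hasDerivAt (2 - ((u + 0) ^ 2 + v ^ 2))
    have h4 := (h1.mul_const v).sub ((h3.comp (0 : ℝ) h2).const_mul s)
    refine (h4.congr_deriv ?_).congr_of_eventuallyEq (Filter.Eventually.of_forall fun t => ?_)
    · simp; ring
    · simp [crossingFn]
  · have h1 : HasDerivAt (fun t : ℝ => v + t) 1 0 := (hasDerivAt_id (0 : ℝ)).const_add v
    have h2 := ((h1.pow 2).const_add (u ^ 2)).const_sub 2
    have h3 := smoothTransition_hasDerivAt (2 - (u ^ 2 + (v + 0) ^ 2))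
    have h4 := (h1.const_mul u).sub ((h3.comp (0 : ℝ) h2).const_mul s)
    refine (h4.congr_deriv ?_).congr_of_eventuallyEq (Filter.Eventually.of_forall fun t => ?_)
    · simp; ring
    · simp [crossingFn]
  · have h1 : HasDerivAt (fun t : ℝ => s + t) 1 0 := (hasDerivAt_id (0 : ℝ)).const_add s
    have h4 := (h1.mul_const (Real.smoothTransition (2 - (u ^ 2 + v ^ 2)))).const_sub (u * v)
    refine (h4.congr_deriv ?_).congr_of_eventuallyEq (Filter.Eventually.of_forall fun t => ?_)
    · simp
    · simp [crossingFn]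

/-- The only horizontally critical zero is the crossing itself. -/
theorem crossingFn_critical {u v s : ℝ} (h0 : crossingFn ((u, v), s) = 0)
    (h1 : fderiv ℝ crossingFn ((u, v), s) ((1, 0), 0) = 0)
    (h2 : fderiv ℝ crossingFn ((u, v), s) ((0, 1), 0) = 0) :
    s = 0 ∧ fderiv ℝ crossingFn ((u, v), s) ((0, 0), 1) = -1 := by
  obtain ⟨e1, e2, e3⟩ := fderiv_crossingFn u v s
  rw [e1] at h1
  rw [e2] at h2
  rw [e3]
  set ρ := Real.smoothTransition (2 - (u ^ 2 + v ^ 2)) with hρ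
  set ρ' := deriv Real.smoothTransition (2 - (u ^ 2 + v ^ 2))
  have p0 : 0 ≤ ρ := Real.smoothTransition.nonneg _
  have p1 : 0 ≤ ρ' := Real.smoothTransition.monotone.deriv_nonneg
  have h0' : u * v = s * ρ := by simp only [crossingFn] at h0; linarith
  have q : 0 ≤ s ^ 2 * ρ * ρ' := by positivity
  have q1 : v ^ 2 + 2 * (s ^ 2 * ρ * ρ') = 0 := by
    have : v * (v + 2 * s * u * ρ') = v ^ 2 + 2 * s * ρ' * (u * v) := by ring
    rw [h1, h0'] at this
    linarith
  have q2 : u ^ 2 + 2 * (s ^ 2 * ρ * ρ') = 0 := by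
    have : u * (u + 2 * s * v * ρ') = u ^ 2 + 2 * s * ρ' * (u * v) := by ring
    rw [h2, h0'] at this
    linarith
  have hv : v = 0 := by nlinarith [sq_nonneg v]
  have hu : u = 0 := by nlinarith [sq_nonneg u]
  have hρ1 : ρ = 1 := by
    rw [hρ, hu, hv]
    exact Real.smoothTransition.one_of_one_le (by norm_num)
  refine ⟨?_, by rw [hρ1]⟩
  rw [hu, hρ1] at h0'
  linarith

theorem crossingFn_far {u v s : ℝ} (h : 2 ≤ u ^ 2 + v ^ 2) : crossingFn ((u, v), s) = u * v := by
  simp only [crossingFn]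
  rw [Real.smoothTransition.zero_of_nonpos (by linarith)]; ring

namespace TangleDiagram

variable {R : Region} {B : Finset Plane} (T : TangleDiagram R B)

/-- The planar curve obtained from the diagram by replacing, inside the disk neighborhood of each
crossing `j`, the crossing by its resolution with parameter `a j`. -/
def resolve (a : Fin T.n → ℝ) : Set Plane :=
  {p | ((∀ j, p ∉ (T.chart j).source) ∧ p ∈ T.carrier) ∨
    ∃ j, p ∈ (T.chart j).source ∧ crossingFn (T.chart j p, a j) = 0}

/-- The family of curves `T.resolve` with parameters varying with the height, as a subset of the
cylinder. -/
def movie (σ : Fin T.n → ℝ → ℝ) : Set Space :=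
  {x | x.2 ∈ Icc (0 : ℝ) 1 ∧ x.1 ∈ T.resolve fun j => σ j x.2}

theorem mem_resolve_of_source {a : Fin T.n → ℝ} {j : Fin T.n} {p : Plane}
    (hp : p ∈ (T.chart j).source) :
    p ∈ T.resolve a ↔ crossingFn (T.chart j p, a j) = 0 := by
  constructor
  · rintro (⟨h, -⟩ | ⟨i, hi, h⟩)
    · exact absurd hp (h j)
    · by_cases hij : i = j
      · subst hij; exact h
      · exact absurd hp (Set.disjoint_left.1 (T.chart_disjoint i j hij) hi)
  · exact fun h => Or.inr ⟨j, hp, h⟩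

/-- The part of the disk neighborhoods where the diagram is modified. -/
def core : Set Plane := ⋃ j, (T.chart j).symm '' {q | q.1 ^ 2 + q.2 ^ 2 ≤ 2}

theorem isCompact_core : IsCompact T.core := by
  have hK : IsCompact {q : Plane | q.1 ^ 2 + q.2 ^ 2 ≤ 2} := by
    refine IsCompact.of_isClosed_subset (isCompact_Icc (a := ((-2, -2) : Plane)) (b := (2, 2)))
      (isClosed_le (by fun_prop) (by fun_prop)) fun q hq => ?_
    simp only [mem_ofPred_eq] at hq
    refine ⟨⟨?_, ?_⟩, ?_, ?_⟩ <;> simp only <;> nlinarith [sq_nonneg q.1, sq_nonneg q.2]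
  exact isCompact_iUnion fun j => hK.image (T.chart_symm_contDiff j).continuous

theorem symm_mem_source (j : Fin T.n) (q : Plane) : (T.chart j).symm q ∈ (T.chart j).source :=
  (T.chart j).map_target (by rw [T.chart_target]; trivial)

theorem core_subset : T.core ⊆ R.carrier := by
  intro p hp
  obtain ⟨j, q, -, rfl⟩ := mem_iUnion.1 hp
  exact (T.chart_source j (T.symm_mem_source j q)).1

theorem mem_core_of_source {j : Fin T.n} {p : Plane} (hp : p ∈ (T.chart j).source)
    (h : (T.chart j p).1 ^ 2 + (T.chart j p).2 ^ 2 ≤ 2) : p ∈ T.core :=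
  mem_iUnion.2 ⟨j, T.chart j p, h, (T.chart j).left_inv hp⟩

theorem mem_resolve_of_not_core {a : Fin T.n → ℝ} {p : Plane} (hp : p ∉ T.core) :
    p ∈ T.resolve a ↔ p ∈ T.carrier := by
  by_cases h : ∃ j, p ∈ (T.chart j).source
  · obtain ⟨j, hj⟩ := h
    rw [T.mem_resolve_of_source hj, T.crossing j p hj, ← mul_eq_zero]
    have : 2 ≤ (T.chart j p).1 ^ 2 + (T.chart j p).2 ^ 2 := by
      by_contra h
      exact hp (T.mem_core_of_source hj (by linarith))
    rw [crossingFn_far this]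
  · push Not at h
    constructor
    · rintro (⟨-, h1⟩ | ⟨i, hi, -⟩)
      · exact h1
      · exact absurd hi (h i)
    · exact fun h1 => Or.inl ⟨h, h1⟩

theorem not_core_of_not_source {p : Plane} (h : ∀ j, p ∉ (T.chart j).source) : p ∉ T.core := by
  intro hp
  obtain ⟨j, q, -, rfl⟩ := mem_iUnion.1 hp
  exact h j (T.symm_mem_source j q)

theorem not_core_of_boundary {p : Plane} (h : p ∈ R.boundary) : p ∉ T.core :=
  T.not_core_of_not_source fun j hj => (T.chart_source j hj).2 h

theorem movie_subset (σ : Fin T.n → ℝ → ℝ) :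
    T.movie σ ⊆ (T.carrier ∪ T.core) ×ˢ Icc (0 : ℝ) 1 := by
  rintro x ⟨hx, h⟩
  refine ⟨?_, hx⟩
  by_cases hc : x.1 ∈ T.core
  · exact Or.inr hc
  · exact Or.inl ((T.mem_resolve_of_not_core hc).1 h)

theorem movie_mem_region {σ : Fin T.n → ℝ → ℝ} {x : Space} (hx : x ∈ T.movie σ) :
    x.1 ∈ R.carrier :=
  (T.movie_subset σ hx).1.elim (fun h => T.subset h) fun h => T.core_subset h

theorem isCompact_movie {σ : Fin T.n → ℝ → ℝ} (hσ : ∀ j, Continuous (σ j)) :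
    IsCompact (T.movie σ) := by
  refine IsCompact.of_isClosed_subset ((T.isCompact.union T.isCompact_core).prod isCompact_Icc)
    ?_ (T.movie_subset σ)
  rw [← isOpen_compl_iff, isOpen_iff_mem_nhds]
  intro x hx
  by_cases hz : x.2 ∈ Icc (0 : ℝ) 1
  swap
  · have : ∀ᶠ y : Space in 𝓝 x, y.2 ∉ Icc (0 : ℝ) 1 :=
      (isClosed_Icc.isOpen_compl.preimage continuous_snd).mem_nhds hz
    filter_upwards [this] with y hy h
    exact hy h.1
  have hx' : x.1 ∉ T.resolve fun j => σ j x.2 := fun h => hx ⟨hz, h⟩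
  by_cases h : ∃ j, x.1 ∈ (T.chart j).source
  · obtain ⟨j, hj⟩ := h
    rw [T.mem_resolve_of_source hj] at hx'
    have ho : ∀ᶠ y : Space in 𝓝 x, y.1 ∈ (T.chart j).source :=
      ((T.chart j).open_source.preimage continuous_fst).mem_nhds hj
    have hc : ContinuousAt (fun y : Space => crossingFn (T.chart j y.1, σ j y.2)) x := by
      refine crossingFn_contDiff.continuous.continuousAt.comp (ContinuousAt.prodMk ?_ ?_)
      · exact ((T.chart j).continuousAt hj).comp continuousAt_fst
      · exact ((hσ j).comp continuous_snd).continuousAt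
    filter_upwards [ho, hc.eventually_ne hx'] with y hy hne hm
    exact hne ((T.mem_resolve_of_source hy).1 hm.2)
  · push Not at h
    have hn := T.not_core_of_not_source h
    rw [T.mem_resolve_of_not_core hn] at hx'
    have o1 : ∀ᶠ y : Space in 𝓝 x, y.1 ∉ T.core :=
      (T.isCompact_core.isClosed.isOpen_compl.preimage continuous_fst).mem_nhds hn
    have o2 : ∀ᶠ y : Space in 𝓝 x, y.1 ∉ T.carrier :=
      (T.isCompact.isClosed.isOpen_compl.preimage continuous_fst).mem_nhds hx'
    filter_upwards [o1, o2] with y h1 h2 hm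
    exact h2 ((T.mem_resolve_of_not_core h1).1 hm.2)

theorem exists_chart_preimage {j : Fin T.n} {p : Plane} (hp : p ∈ (T.chart j).source)
    (w : Plane) : ∃ v, fderiv ℝ (T.chart j) p v = w := by
  have h := T.chart_orientation j p hp
  have h1 : IsUnit (fderiv ℝ (T.chart j) p).det := isUnit_iff_ne_zero.2 h.ne'
  exact ⟨_, ((fderiv ℝ (T.chart j) p).toContinuousLinearEquivOfDetNeZero h.ne').apply_symm_apply w⟩

theorem movie_surfaceAt {σ : Fin T.n → ℝ → ℝ} (hσ : ∀ j, ContDiff ℝ ∞ (σ j))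
    (hreg : ∀ j z, σ j z = 0 → deriv (σ j) z ≠ 0) {x : Space} (hx : x ∈ T.movie σ) :
    SurfaceAt R (T.movie σ) x := by
  by_cases h : ∃ j, x.1 ∈ (T.chart j).source
  · obtain ⟨j, hj⟩ := h
    have hx2 := (T.mem_resolve_of_source hj).1 hx.2
    let g : Space → Space := fun y => (T.chart j y.1, σ j y.2)
    let U : Set Space := Prod.fst ⁻¹' (T.chart j).source
    have hU : IsOpen U := (T.chart j).open_source.preimage continuous_fst
    have hgU : ContDiffOn ℝ ∞ g U :=
      ((T.chart_contDiff j).comp contDiffOn_fst fun y hy => hy).prodMk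
        ((hσ j).comp contDiff_snd).contDiffOn
    have hc : DifferentiableAt ℝ (T.chart j) x.1 :=
      ((T.chart_contDiff j).contDiffAt ((T.chart j).open_source.mem_nhds hj)).differentiableAt
        (by simp)
    have hs : HasDerivAt (σ j) (deriv (σ j) x.2) x.2 :=
      ((hσ j).differentiable (by simp) x.2).hasDerivAt
    have hg : HasFDerivAt g
        (((fderiv ℝ (T.chart j) x.1).comp (ContinuousLinearMap.fst ℝ Plane ℝ)).prod
          ((ContinuousLinearMap.toSpanSingleton ℝ (deriv (σ j) x.2)).comp
            (ContinuousLinearMap.snd ℝ Plane ℝ))) x :=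
      (hc.hasFDerivAt.comp x hasFDerivAt_fst).prodMk
        (hs.hasFDerivAt.comp x hasFDerivAt_snd)
    have hk : HasFDerivAt crossingFn (fderiv ℝ crossingFn (g x)) (g x) :=
      (crossingFn_contDiff.differentiable (by simp) (g x)).hasFDerivAt
    have key := (hk.comp x hg).fderiv
    refine ⟨U, hU, hj, fun y => crossingFn (g y), crossingFn_contDiff.comp_contDiffOn hgU,
      fun h0 => ?_, fun hb => absurd hb (T.chart_source j hj).2, fun y hy => ?_⟩
    · have h0' : ∀ v : Space, fderiv ℝ crossingFn (g x)
          (fderiv ℝ (T.chart j) x.1 v.1, v.2 * deriv (σ j) x.2) = 0 := by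
        intro v
        have : fderiv ℝ (crossingFn ∘ g) x v = 0 := by
          change fderiv ℝ (fun y => crossingFn (g y)) x v = 0
          rw [h0]; rfl
        rw [key] at this
        simpa using this
      obtain ⟨v1, hv1⟩ := T.exists_chart_preimage hj (1, 0)
      obtain ⟨v2, hv2⟩ := T.exists_chart_preimage hj (0, 1)
      have d1 := h0' (v1, 0)
      have d2 := h0' (v2, 0)
      have d3 := h0' (0, 1)
      simp only [hv1, hv2, zero_mul, map_zero, one_mul] at d1 d2 d3
      have hx3 : crossingFn (((T.chart j x.1).1, (T.chart j x.1).2), σ j x.2) = 0 := hx2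
      obtain ⟨hs0, hs1⟩ := crossingFn_critical hx3 d1 d2
      apply hreg j x.2 hs0
      have : ((0 : Plane), deriv (σ j) x.2) = deriv (σ j) x.2 • (((0, 0), 1) : Space) := by
        exact Prod.ext (by simp; rfl) (by simp)
      rw [this, map_smul] at d3
      change deriv (σ j) x.2 • fderiv ℝ crossingFn
        (((T.chart j x.1).1, (T.chart j x.1).2), σ j x.2) ((0, 0), 1) = 0 at d3
      rw [hs1, smul_eq_mul] at d3
      linarith
    · have hy' : y.1 ∈ (T.chart j).source := hy
      have hR := (T.chart_source j hy').1
      change (y.2 ∈ Icc (0 : ℝ) 1 ∧ y.1 ∈ T.resolve fun j => σ j y.2) ↔ _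
      rw [T.mem_resolve_of_source hy']
      exact ⟨fun h => ⟨hR, h⟩, fun h => h.2⟩
  · push Not at h
    have hn := T.not_core_of_not_source h
    have hx2 := (T.mem_resolve_of_not_core hn).1 hx.2
    refine CurveAt.surfaceAt (T.curveAt x.1 hx2 fun j hj => h j ?_)
      (V := Prod.fst ⁻¹' T.coreᶜ)
      (T.isCompact_core.isClosed.isOpen_compl.preimage continuous_fst) hn fun y hy => ?_
    · rw [hj]; exact T.symm_mem_source j 0
    · change (y.2 ∈ Icc (0 : ℝ) 1 ∧ y.1 ∈ T.resolve fun j => σ j y.2) ↔ _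
      rw [T.mem_resolve_of_not_core hy]

theorem movie_wall {σ : Fin T.n → ℝ → ℝ} {p : Plane} (hp : p ∈ R.boundary) {z : ℝ}
    (hz : z ∈ Icc (0 : ℝ) 1) : (p, z) ∈ T.movie σ ↔ p ∈ B := by
  rw [← T.boundary p hp, ← T.mem_resolve_of_not_core (T.not_core_of_boundary hp)]
  exact ⟨fun h => h.2, fun h => ⟨hz, h⟩⟩

theorem resolve_curveAt {a : Fin T.n → ℝ} (ha : ∀ j, a j ≠ 0) {p : Plane}
    (hp : p ∈ T.resolve a) : CurveAt R (T.resolve a) p := by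
  have hM : ∀ q, (q, (0 : ℝ)) ∈ T.movie (fun j _ => a j) ↔ q ∈ T.resolve a := fun q =>
    ⟨fun h => h.2, fun h => ⟨⟨le_rfl, zero_le_one⟩, h⟩⟩
  by_cases h : ∃ j, p ∈ (T.chart j).source
  · obtain ⟨j, hj⟩ := h
    have hp2 := (T.mem_resolve_of_source hj).1 hp
    have hc : DifferentiableAt ℝ (T.chart j) p :=
      ((T.chart_contDiff j).contDiffAt ((T.chart j).open_source.mem_nhds hj)).differentiableAt
        (by simp)
    let g : Plane → Space := fun q => (T.chart j q, a j)
    have hg : HasFDerivAt g ((fderiv ℝ (T.chart j) p).prod 0) p :=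
      hc.hasFDerivAt.prodMk (hasFDerivAt_const (a j) p)
    have hk : HasFDerivAt crossingFn (fderiv ℝ crossingFn (g p)) (g p) :=
      (crossingFn_contDiff.differentiable (by simp) (g p)).hasFDerivAt
    have key := (hk.comp p hg).fderiv
    refine ⟨(T.chart j).source, (T.chart j).open_source, hj, fun q => crossingFn (g q),
      crossingFn_contDiff.comp_contDiffOn ((T.chart_contDiff j).prodMk contDiffOn_const),
      fun h0 => ?_, fun hb => absurd hb (T.chart_source j hj).2, fun q hq => ?_⟩
    · have h0' : ∀ v : Plane, fderiv ℝ crossingFn (g p) (fderiv ℝ (T.chart j) p v, 0) = 0 := by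
        intro v
        have : fderiv ℝ (crossingFn ∘ g) p v = 0 := by
          change fderiv ℝ (fun y => crossingFn (g y)) p v = 0
          rw [h0]; rfl
        rw [key] at this
        simpa using this
      obtain ⟨v1, hv1⟩ := T.exists_chart_preimage hj (1, 0)
      obtain ⟨v2, hv2⟩ := T.exists_chart_preimage hj (0, 1)
      have d1 := h0' v1
      have d2 := h0' v2
      rw [hv1] at d1
      rw [hv2] at d2
      have hx3 : crossingFn (((T.chart j p).1, (T.chart j p).2), a j) = 0 := hp2
      exact ha j (crossingFn_critical hx3 d1 d2).1
    · rw [T.mem_resolve_of_source hq]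
      exact ⟨fun h => ⟨(T.chart_source j hq).1, h⟩, fun h => h.2⟩
  · push Not at h
    have hn := T.not_core_of_not_source h
    have hp2 := (T.mem_resolve_of_not_core hn).1 hp
    obtain ⟨U, hU, hpU, f, hf, hd, hb, hγ⟩ := T.curveAt p hp2 fun j hj => h j (by
      rw [hj]; exact T.symm_mem_source j 0)
    refine ⟨U ∩ T.coreᶜ, hU.inter T.isCompact_core.isClosed.isOpen_compl, ⟨hpU, hn⟩, f,
      hf.mono inter_subset_left, hd, hb, fun q hq => ?_⟩
    rw [T.mem_resolve_of_not_core hq.2]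
    exact hγ q hq.1

/-- The parameter of a smoothing: the `0`-smoothing (entering along the lower strand and turning
right) has parameter `-1`, the `1`-smoothing (entering along the upper strand and turning right)
has parameter `1`. -/
def level (b : Bool) : ℝ := if b then 1 else -1

theorem level_ne_zero (b : Bool) : level b ≠ 0 := by cases b <;> norm_num [level]

/-- The smoothing at the vertex `v` of the cube; `true` stands for `1` and `false` for `0`. -/
def smoothing (v : Fin T.n → Bool) : Smoothing R B where
  carrier := T.resolve fun j => level (v j)
  isCompact := by
    have := (T.isCompact_movie (σ := fun j _ => level (v j)) fun _ => continuous_const).image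
      continuous_fst
    convert this using 1
    ext p
    constructor
    · exact fun h => ⟨(p, 0), ⟨⟨le_rfl, zero_le_one⟩, h⟩, rfl⟩
    · rintro ⟨x, hx, rfl⟩
      exact hx.2
  subset p hp := T.movie_mem_region (σ := fun j _ => level (v j)) (x := (p, 0))
    ⟨⟨le_rfl, zero_le_one⟩, hp⟩
  curveAt p hp := T.resolve_curveAt (fun j => level_ne_zero (v j)) hp
  boundary p hp := by
    rw [T.mem_resolve_of_not_core (T.not_core_of_boundary hp)]
    exact T.boundary p hp

/-- The profile of the saddle: a smooth function, equal to `level true` near the bottom and to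
`level false` near the top, with regular zeros. -/
def saddleProfile (z : ℝ) : ℝ := 1 - 2 * Real.smoothTransition (3 * z - 1)

theorem saddleProfile_contDiff : ContDiff ℝ ∞ saddleProfile :=
  contDiff_const.sub (contDiff_const.mul (Real.smoothTransition.contDiff.comp (by fun_prop)))

theorem saddleProfile_bottom {z : ℝ} (hz : z ≤ 1 / 3) : saddleProfile z = level true := by
  rw [saddleProfile, Real.smoothTransition.zero_of_nonpos (by linarith)]; norm_num [level]

theorem saddleProfile_top {z : ℝ} (hz : 2 / 3 ≤ z) : saddleProfile z = level false := by
  rw [saddleProfile, Real.smoothTransition.one_of_one_le (by linarith)]; norm_num [level]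

theorem smoothTransition_deriv_pos {x : ℝ} (h0 : 0 < x) (h1 : x < 1) :
    0 < deriv Real.smoothTransition x := by
  have hd : ∀ y, HasDerivAt expNegInvGlue (y⁻¹ ^ 2 * expNegInvGlue y) y := by
    intro y
    have := expNegInvGlue.hasDerivAt_polynomial_eval_inv_mul 1 y
    simpa using this
  have e1 := hd x
  have e2 : HasDerivAt (fun y => expNegInvGlue (1 - y))
      ((1 - x)⁻¹ ^ 2 * expNegInvGlue (1 - x) * (-1)) x :=
    (hd (1 - x)).comp x ((hasDerivAt_id x).const_sub 1)
  have p1 := expNegInvGlue.pos_of_pos h0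
  have p2 := expNegInvGlue.pos_of_pos (show 0 < 1 - x by linarith)
  have hD := Real.smoothTransition.pos_denom x
  have e3 := e1.div (e1.add e2) hD.ne'
  have e4 : HasDerivAt Real.smoothTransition _ x := e3
  rw [e4.deriv]
  refine div_pos ?_ (pow_pos hD 2)
  have q1 : 0 < x⁻¹ ^ 2 := by positivity
  have q2 : 0 < (1 - x)⁻¹ ^ 2 := by
    have : 0 < 1 - x := by linarith
    positivity
  simp only [Pi.add_apply]
  have : x⁻¹ ^ 2 * expNegInvGlue x * (expNegInvGlue x + expNegInvGlue (1 - x)) -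
      expNegInvGlue x * (x⁻¹ ^ 2 * expNegInvGlue x +
        (1 - x)⁻¹ ^ 2 * expNegInvGlue (1 - x) * (-1)) =
      (x⁻¹ ^ 2 + (1 - x)⁻¹ ^ 2) * (expNegInvGlue x * expNegInvGlue (1 - x)) := by ring
  rw [this]
  positivity

theorem saddleProfile_regular {z : ℝ} (h : saddleProfile z = 0) : deriv saddleProfile z ≠ 0 := by
  have h1 : Real.smoothTransition (3 * z - 1) = 1 / 2 := by
    simp only [saddleProfile] at h; linarith
  have p0 : 0 < 3 * z - 1 := by
    by_contra hc
    rw [Real.smoothTransition.zero_of_nonpos (by linarith)] at h1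
    norm_num at h1
  have p1 : 3 * z - 1 < 1 := by
    by_contra hc
    rw [Real.smoothTransition.one_of_one_le (by linarith)] at h1
    norm_num at h1
  have hz : HasDerivAt (fun z : ℝ => 3 * z - 1) 3 z := by
    simpa using ((hasDerivAt_id z).const_mul 3).sub_const 1
  have hc : HasDerivAt (fun z : ℝ => Real.smoothTransition (3 * z - 1))
      (deriv Real.smoothTransition (3 * z - 1) * 3) z :=
    HasDerivAt.comp (h₂ := Real.smoothTransition) (h := fun z : ℝ => 3 * z - 1) z
      (smoothTransition_hasDerivAt (3 * z - 1)) hz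
  have hd : HasDerivAt saddleProfile (-(2 * (deriv Real.smoothTransition (3 * z - 1) * 3))) z :=
    (hc.const_mul 2).const_sub 1
  rw [hd.deriv]
  have := smoothTransition_deriv_pos p0 p1
  intro h0
  linarith

/-- The edges of the cube: `w` is obtained from `v` by changing the `j`-th coordinate from
`0` to `1`. -/
def IsEdge (v w : Fin T.n → Bool) (j : Fin T.n) : Prop :=
  v j = false ∧ w = Function.update v j true

/-- The crossing parameters, as functions of the height, of the cobordism on the edge starting at
`v` in the direction `j`. -/
def edgeProfile (v : Fin T.n → Bool) (j i : Fin T.n) : ℝ → ℝ :=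
  if i = j then saddleProfile else fun _ => level (v i)

theorem edgeProfile_contDiff (v : Fin T.n → Bool) (j i : Fin T.n) :
    ContDiff ℝ ∞ (T.edgeProfile v j i) := by
  unfold edgeProfile
  split_ifs
  · exact saddleProfile_contDiff
  · exact contDiff_const

theorem edgeProfile_regular (v : Fin T.n → Bool) (j i : Fin T.n) (z : ℝ)
    (h : T.edgeProfile v j i z = 0) : deriv (T.edgeProfile v j i) z ≠ 0 := by
  unfold edgeProfile at h ⊢
  split_ifs at h ⊢ with hij
  · exact saddleProfile_regular h
  · exact absurd h (level_ne_zero _)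

/-- The cobordism on an edge of the cube, from the smoothing at its tail (at the top) to the
smoothing at its head (at the bottom): the product of the smoothing with `[0, 1]` outside the
neighborhood of the `j`-th crossing, and a saddle inside this neighborhood. -/
def saddle {v w : Fin T.n → Bool} {j : Fin T.n} (h : T.IsEdge v w j) :
    EmbeddedCobordism (T.smoothing v) (T.smoothing w) where
  carrier := T.movie (T.edgeProfile v j)
  isCompact := T.isCompact_movie fun i => (T.edgeProfile_contDiff v j i).continuous
  subset x hx := ⟨T.movie_mem_region hx, hx.1⟩
  surfaceAt _ hx := T.movie_surfaceAt (T.edgeProfile_contDiff v j) (T.edgeProfile_regular v j) hx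
  wall _ hp _ hz := T.movie_wall hp hz
  top := by
    refine ⟨1 / 3, by norm_num, by norm_num, fun p z h1 h2 => ?_⟩
    have e : (fun i => T.edgeProfile v j i z) = fun i => level (v i) := by
      funext i
      unfold edgeProfile
      split_ifs with hij
      · rw [saddleProfile_top (by linarith), hij, h.1]
      · rfl
    change (z ∈ Icc (0 : ℝ) 1 ∧ p ∈ T.resolve fun i => T.edgeProfile v j i z) ↔ _
    rw [e]
    exact ⟨fun h => h.2, fun h => ⟨⟨by linarith, h2⟩, h⟩⟩
  bottom := by
    refine ⟨1 / 3, by norm_num, by norm_num, fun p z h1 h2 => ?_⟩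
    have e : (fun i => T.edgeProfile v j i z) = fun i => level (w i) := by
      funext i
      unfold edgeProfile
      rw [h.2]
      split_ifs with hij
      · rw [saddleProfile_bottom (by linarith), hij, Function.update_self]
      · rw [Function.update_of_ne hij]
    change (z ∈ Icc (0 : ℝ) 1 ∧ p ∈ T.resolve fun i => T.edgeProfile v j i z) ↔ _
    rw [e]
    exact ⟨fun h => h.2, fun h => ⟨⟨h1, by linarith⟩, h⟩⟩

/-- The morphism of `Cob³(B)` on an edge of the cube. -/
def edge {v w : Fin T.n → Bool} {j : Fin T.n} (h : T.IsEdge v w j) :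
    T.smoothing v ⟶ T.smoothing w :=
  Quotient.mk _ (T.saddle h)

/-! ### The formal Khovanov bracket -/

/-- The sign of a crossing. -/
def crossingSign (j : Fin T.n) : ℤˣ := T.upper j * T.lower j

/-- The number of positive crossings. -/
def nPlus : ℕ := (Finset.univ.filter fun j => T.crossingSign j = 1).card

/-- The number of negative crossings. -/
def nMinus : ℕ := (Finset.univ.filter fun j => T.crossingSign j = -1).card

/-- The height of a vertex of the cube: the sum of its coordinates. -/
def height (v : Fin T.n → Bool) : ℕ := (Finset.univ.filter fun i => v i = true).card

/-- The sign on the edge starting at `v` in the direction `j`. -/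
def edgeSign (v : Fin T.n → Bool) (j : Fin T.n) : ℤ :=
  (-1) ^ (Finset.univ.filter fun i => i < j ∧ v i = true).card

/-- The chain object in degree `r`: the formal direct sum of the smoothings at height `r + n₋`. -/
def chain (r : ℤ) : Mat_ (PreaddCob R B) where
  ι := {v : Fin T.n → Bool // (T.height v : ℤ) = r + T.nMinus}
  X v := (Free.embedding ℤ (Smoothing R B)).obj (T.smoothing v.1)

open scoped Classical in
/-- The matrix entry of the differential from the vertex `v` to the vertex `w`: the signed edge
cobordism if there is an edge from `v` to `w`, and zero otherwise. -/
def entry (v w : Fin T.n → Bool) :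
    (Free.embedding ℤ (Smoothing R B)).obj (T.smoothing v) ⟶
      (Free.embedding ℤ (Smoothing R B)).obj (T.smoothing w) :=
  ∑ j, if h : T.IsEdge v w j then
    T.edgeSign v j • (Free.embedding ℤ (Smoothing R B)).map (T.edge h) else 0

/-- The differential of the formal Khovanov bracket, from degree `r` to degree `r + 1`. -/
def d (r : ℤ) : T.chain r ⟶ T.chain (r + 1) := fun v w => T.entry v.1 w.1

end TangleDiagram

end

end TangleBracket

/-! An entry of the squared differential is a sum over the paths of length two in the cube from `v`
to `w`. Such a path raises two distinct coordinates `i`, `j` of `v` from `0` to `1`, and exactly one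
other path has the same ends: the one raising them in the opposite order. So the claim reduces to
two facts about a square face of the cube: its two composite cobordisms are isotopic, and its four
edge signs multiply to `-1`.

Geometry. Each composite is vertical except over the disjoint disks of crossings `i` and `j`, where
it has one saddle each, at different heights; the two composites differ only in which saddle is
higher. Saddles over disjoint disks can be slid past each other vertically. To make this precise, a
composite is written as a `movie`, whose slice at height `z` is the resolution of the diagram with a
parameter depending on `z` at each crossing (`saddle_comp_carrier`). By `movie_isotopic`, the height
may be reparametrized by a different function over each disk, cut off to the identity by a bump
function. The cutoff takes place where the resolution no longer depends on its parameter, so the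
surface is vertical there and is moved along itself. `squareProfile_isotopic` applies this to
exchange the heights of the two saddles.

Signs. The sign of an edge in direction `i` counts the ones before `i`. Raising the smaller of the
two coordinates therefore flips the sign of the edge in the larger direction, while raising the
larger changes nothing (`edgeSign_square`).

Exchanging the order of the two directions is then a fixed-point-free involution on paths that
cancels them in pairs (`sum_entry_comp_entry`). For the finite length, the height of a vertex lies
between `0` and `n = n₊ + n₋`, so in all other degrees the direct sum is empty. -/

namespace TangleBracket

/-! ### Shifting a window of heights -/

/-- A reparametrization which is a translation on a given interval and the identity near the
ends. -/
theorem exists_repar_shift {a b c : ℝ} (ha : 0 < a) (hab : a < b) (hb : b < 1) (hac : 0 < a + c)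
    (hbc : b + c < 1) : ∃ h, IsRepar h ∧ (∃ ε > 0, ∀ z, z ≤ ε ∨ 1 - ε ≤ z → h z = z) ∧
      ∀ z, a ≤ z → z ≤ b → h z = z + c := by
  -- The identity zones must end before both the window `[a, b]` and its translate `[a + c, b + c]`
  -- begin, so that `exists_join` has an increasing gap to fill on either side.
  obtain ⟨ε, hε, e1, e2, e3, e4⟩ : ∃ ε > 0, ε < a ∧ ε < a + c ∧ ε < 1 - b ∧ ε < 1 - (b + c) := by
    obtain ⟨δ, hδ, hδ'⟩ := exists_between
      (lt_min (lt_min ha hac) (lt_min (sub_pos.2 hb) (sub_pos.2 hbc)))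
    simp only [lt_min_iff] at hδ'
    exact ⟨δ, hδ, hδ'.1.1, hδ'.1.2, hδ'.2.1, hδ'.2.2⟩
  obtain ⟨j, hj, j1, j2⟩ := exists_join (a := ε) (b := a) (A := ε) (B := a + c) (m := 1) (n := 1)
    e1 e2 one_pos one_pos
  obtain ⟨k, hk, k1, k2⟩ := exists_join (a := b) (b := 1 - ε) (A := b + c) (B := 1 - ε) (m := 1)
    (n := 1) (by linarith) (by linarith) one_pos one_pos
  -- Both joins equal `z + c` on all of `[a, b]`, so switching from one to the other at the midpoint
  -- is smooth.
  refine ⟨_, hj.glue hk (a := a) (b := b) (c := (a + b) / 2) (by linarith) (by linarith)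
    fun z h1 h2 => ?_, ⟨ε, hε, ?_⟩, fun z h1 h2 => ?_⟩
  · rw [j2 z h1, k1 z h2]; ring
  · rintro z (hz | hz)
    · rw [if_pos (by linarith), j1 z hz]; ring
    · rw [if_neg (by linarith), k2 z hz]; ring
  · split_ifs
    · rw [j2 z h1]; ring
    · rw [k1 z h2]; ring

theorem IsRepar.id : IsRepar fun z => z :=
  ⟨contDiff_id, fun z => by simp⟩

namespace TangleDiagram

variable {R : Region} {B : Finset Plane} (T : TangleDiagram R B)

/-! ### Moving each crossing to its own heights -/

open scoped Classical in
/-- A smooth function equal to `1` on the part of the `j`-th disk neighborhood where the diagram is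
modified, and supported in this neighborhood. -/
noncomputable def bump (j : Fin T.n) (p : Plane) : ℝ :=
  if p ∈ (T.chart j).source then
    Real.smoothTransition (3 - ((T.chart j p).1 ^ 2 + (T.chart j p).2 ^ 2)) else 0

/-- Extension by zero stays smooth because the support lies in the image of the closed disk `r² ≤ 3`
under the inverse chart. This image is compact, hence closed in the whole plane, so every point
outside the chart domain has a neighborhood on which the function vanishes. -/
theorem bump_contDiff (j : Fin T.n) : ContDiff ℝ ∞ (T.bump j) := by
  rw [contDiff_iff_contDiffAt]
  intro p
  by_cases hp : p ∈ (T.chart j).source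
  · have h1 : ContDiffAt ℝ ∞ (T.chart j) p :=
      (T.chart_contDiff j).contDiffAt ((T.chart j).open_source.mem_nhds hp)
    have h2 : ContDiff ℝ ∞ fun q : Plane =>
        Real.smoothTransition (3 - (q.1 ^ 2 + q.2 ^ 2)) :=
      Real.smoothTransition.contDiff.comp (by fun_prop)
    refine (h2.contDiffAt.comp p h1).congr_of_eventuallyEq ?_
    filter_upwards [(T.chart j).open_source.mem_nhds hp] with q hq
    exact if_pos hq
  · have hK : IsCompact ((T.chart j).symm '' {q : Plane | q.1 ^ 2 + q.2 ^ 2 ≤ 3}) := by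
      refine IsCompact.image (IsCompact.of_isClosed_subset
        (isCompact_Icc (a := ((-2, -2) : Plane)) (b := (2, 2)))
        (isClosed_le (by fun_prop) (by fun_prop)) fun q hq => ?_)
        (T.chart_symm_contDiff j).continuous
      simp only [mem_ofPred_eq] at hq
      refine ⟨⟨?_, ?_⟩, ?_, ?_⟩ <;> simp only <;> nlinarith [sq_nonneg q.1, sq_nonneg q.2]
    have hpK : p ∉ (T.chart j).symm '' {q : Plane | q.1 ^ 2 + q.2 ^ 2 ≤ 3} := by
      rintro ⟨q, -, rfl⟩
      exact hp (T.symm_mem_source j q)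
    refine (contDiffAt_const (c := (0 : ℝ))).congr_of_eventuallyEq ?_
    filter_upwards [hK.isClosed.isOpen_compl.mem_nhds hpK] with q hq
    unfold bump
    split_ifs with hs
    · refine Real.smoothTransition.zero_of_nonpos ?_
      by_contra hc
      exact hq ⟨T.chart j q, by simp only [mem_ofPred_eq]; linarith, (T.chart j).left_inv hs⟩
    · rfl

theorem bump_nonneg (j : Fin T.n) (p : Plane) : 0 ≤ T.bump j p := by
  unfold bump
  split_ifs
  · exact Real.smoothTransition.nonneg _
  · exact le_rfl

theorem bump_le_one (j : Fin T.n) (p : Plane) : T.bump j p ≤ 1 := by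
  unfold bump
  split_ifs
  · exact Real.smoothTransition.le_one _
  · exact zero_le_one

theorem bump_eq_zero {j : Fin T.n} {p : Plane} (hp : p ∉ (T.chart j).source) : T.bump j p = 0 :=
  if_neg hp

/-- The cutoff `3 - r²` is chosen so that the plateau is the disk `r² ≤ 2`, exactly the one outside
which `crossingFn` is independent of its parameter (`crossingFn_far`). -/
theorem bump_eq_one {j : Fin T.n} {p : Plane} (hp : p ∈ (T.chart j).source)
    (h : (T.chart j p).1 ^ 2 + (T.chart j p).2 ^ 2 ≤ 2) : T.bump j p = 1 := by
  rw [bump, if_pos hp]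
  exact Real.smoothTransition.one_of_one_le (by linarith)

/-- The disks are disjoint, so at most one bump is nonzero at any point. -/
theorem sum_bump_of_source {j : Fin T.n} {p : Plane} (hp : p ∈ (T.chart j).source)
    (f : Fin T.n → ℝ) : ∑ i, T.bump i p * f i = T.bump j p * f j := by
  refine Finset.sum_eq_single j (fun i _ hij => ?_) fun h => absurd (Finset.mem_univ j) h
  rw [T.bump_eq_zero (Set.disjoint_right.1 (T.chart_disjoint i j hij) hp), zero_mul]

/-- The heights of the crossing resolutions can be changed independently at the crossings. -/
theorem movie_isotopic {σ τ : Fin T.n → ℝ → ℝ} {h : Fin T.n → ℝ → ℝ} (hh : ∀ j, IsRepar (h j))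
    {ε : ℝ} (hε : 0 < ε) (hid : ∀ j z, z ≤ ε ∨ 1 - ε ≤ z → h j z = z)
    (hστ : ∀ j z, σ j z = τ j (h j z)) : IsIsotopic R (T.movie σ) (T.movie τ) := by
  -- The isotopy moves the vertical line over `p` by `z ↦ z + ∑ j, bump j p * (h j z - z)`. This is
  -- `h j` over the modified part of the `j`-th disk and the identity away from all disks.
  have hd : ∀ (p : Plane) (z : ℝ), HasDerivAt (fun z => z + ∑ j, T.bump j p * (h j z - z))
      (1 + ∑ j, T.bump j p * (deriv (h j) z - 1)) z := fun p z =>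
    (hasDerivAt_id z).add (HasDerivAt.fun_sum fun j _ =>
      ((((hh j).1.differentiable (by simp) z).hasDerivAt.sub (hasDerivAt_id z)).const_mul _))
  have hpos : ∀ (p : Plane) (z : ℝ), 0 < deriv (fun z => z + ∑ j, T.bump j p * (h j z - z)) z := by
    intro p z
    rw [(hd p z).deriv]
    by_cases hp : ∃ j, p ∈ (T.chart j).source
    · obtain ⟨j, hj⟩ := hp
      -- With a single bump `b` left, the derivative is the convex combination `(1 - b) + b * h'` of
      -- positive numbers.
      rw [T.sum_bump_of_source hj]
      have h1 := T.bump_nonneg j p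
      have h2 := T.bump_le_one j p
      have h3 := (hh j).2 z
      rcases eq_or_lt_of_le h1 with h4 | h4
      · rw [← h4]; norm_num
      · nlinarith [mul_pos h4 h3]
    · push Not at hp
      rw [Finset.sum_eq_zero fun j _ => by rw [T.bump_eq_zero (hp j), zero_mul]]
      norm_num
  have hends : ∀ (p : Plane) (z : ℝ), z ≤ ε ∨ 1 - ε ≤ z →
      z + ∑ j, T.bump j p * (h j z - z) = z := by
    intro p z hz
    rw [Finset.sum_eq_zero fun j _ => by rw [hid j z hz, sub_self, mul_zero], add_zero]
  refine isIsotopic_of_vertical (fun x => x.2 + ∑ j, T.bump j x.1 * (h j x.2 - x.2)) ?_ hpos hε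
    hends fun p z => ?_
  · exact contDiff_snd.add (ContDiff.sum fun j _ => ((T.bump_contDiff j).comp contDiff_fst).mul
      (((hh j).1.comp contDiff_snd).sub contDiff_snd))
  · have mono : StrictMono fun z => z + ∑ j, T.bump j p * (h j z - z) :=
      strictMono_of_deriv_pos (hpos p)
    -- The map is strictly increasing and fixes `0` and `1`, hence preserves the range of heights of
    -- the cylinder.
    have hI : z ∈ Icc (0 : ℝ) 1 ↔ z + ∑ j, T.bump j p * (h j z - z) ∈ Icc (0 : ℝ) 1 := by
      have e0 := mono.le_iff_le (a := 0) (b := z)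
      have e1 := mono.le_iff_le (a := z) (b := 1)
      simp only [hends p 0 (Or.inl hε.le), hends p 1 (Or.inr (by linarith))] at e0 e1
      rw [mem_Icc, mem_Icc, e0, e1]
    refine and_congr hI ?_
    change p ∈ T.resolve _ ↔ p ∈ T.resolve _
    -- Over the core the bump is `1`, so the new height is `h j z` and the hypothesis relating `σ`
    -- and `τ` applies. Off the core the resolved curve is the diagram itself for all parameters, so
    -- the change of height is invisible.
    by_cases hc : p ∈ T.core
    · obtain ⟨j, q, hq, rfl⟩ := mem_iUnion.1 hc
      have hs := T.symm_mem_source j q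
      have hr : T.chart j ((T.chart j).symm q) = q :=
        (T.chart j).right_inv (by rw [T.chart_target]; trivial)
      rw [T.mem_resolve_of_source hs, T.mem_resolve_of_source hs]
      simp only
      rw [T.sum_bump_of_source hs, T.bump_eq_one hs (by rw [hr]; exact hq), hστ]
      ring_nf
    · rw [T.mem_resolve_of_not_core hc, T.mem_resolve_of_not_core hc]

/-! ### Commuting squares of saddles -/

/-- The crossing parameters of the composition of two saddles, in the direction `j` at the top and
in the direction `i` at the bottom. -/
noncomputable def squareProfile (v : Fin T.n → Bool) (j i k : Fin T.n) : ℝ → ℝ :=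
  if k = j then fun z => saddleProfile (2 * z - 1) else
    if k = i then fun z => saddleProfile (2 * z) else fun _ => level (v k)

/-- The sets agree exactly, with no isotopy needed. In the upper half the profile `saddleProfile (2
* z)` of crossing `i` has already reached its top value, the level of `v i = false`; in the lower
half the profile `saddleProfile (2 * z - 1)` of crossing `j` sits at its bottom value, the level of
`u j = true`. -/
theorem saddle_comp_carrier {v u w : Fin T.n → Bool} {i j : Fin T.n} (h : T.IsEdge v u j)
    (h' : T.IsEdge u w i) :
    ((T.saddle h).comp (T.saddle h')).carrier = T.movie (T.squareProfile v j i) := by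
  -- A coordinate raised by the first edge cannot be raised again by the second.
  have hij : i ≠ j := by
    rintro rfl
    have := h'.1
    rw [h.2, Function.update_self] at this
    exact Bool.noConfusion this
  have hvi : v i = false := by
    have := h'.1
    rwa [h.2, Function.update_of_ne hij] at this
  ext ⟨p, z⟩
  rcases le_total (1 / 2) z with hz | hz
  · refine (EmbeddedCobordism.mem_stack_upper _ _ hz).trans (and_congr ?_ ?_)
    · simp only [mem_Icc]
      constructor <;> rintro ⟨h1, h2⟩ <;> constructor <;> linarith
    · have e : (fun k => T.edgeProfile v j k (2 * z - 1)) = fun k => T.squareProfile v j i k z := by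
        funext k
        unfold edgeProfile squareProfile
        split_ifs with h1 h2
        · rfl
        · dsimp only
          rw [saddleProfile_top (by linarith), h2, hvi]
        · rfl
      change p ∈ T.resolve (fun k => T.edgeProfile v j k (2 * z - 1)) ↔ _
      rw [e]
  · refine (EmbeddedCobordism.mem_stack_lower _ _ hz).trans (and_congr ?_ ?_)
    · simp only [mem_Icc]
      constructor <;> rintro ⟨h1, h2⟩ <;> constructor <;> linarith
    · have e : (fun k => T.edgeProfile u i k (2 * z)) = fun k => T.squareProfile v j i k z := by
        funext k
        unfold edgeProfile squareProfile
        rw [h.2]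
        split_ifs with h1 h2 h2
        · exact absurd (h1.symm.trans h2) hij
        · rfl
        · dsimp only
          rw [saddleProfile_bottom (by linarith), h2, Function.update_self]
        · rw [Function.update_of_ne h2]
      change p ∈ T.resolve (fun k => T.edgeProfile u i k (2 * z)) ↔ _
      rw [e]

/-- `saddleProfile` varies only on `[1/3, 2/3]`, so the upper saddle lives at heights `[2/3, 5/6]`
and the lower one at `[1/6, 1/3]`. Shifting the first window down by `1/2` and the second up by
`1/2` exchanges them. The two shifts act over different disks and need not be compatible with each
other. -/
theorem squareProfile_isotopic (v : Fin T.n → Bool) {i j : Fin T.n} (hij : i ≠ j) :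
    IsIsotopic R (T.movie (T.squareProfile v j i)) (T.movie (T.squareProfile v i j)) := by
  obtain ⟨f, hf, ⟨ε, hε, f1⟩, f2⟩ := exists_repar_shift (a := 2 / 3) (b := 5 / 6) (c := -(1 / 2))
    (by norm_num) (by norm_num) (by norm_num) (by norm_num) (by norm_num)
  obtain ⟨g, hg, ⟨δ, hδ, g1⟩, g2⟩ := exists_repar_shift (a := 1 / 6) (b := 1 / 3) (c := 1 / 2)
    (by norm_num) (by norm_num) (by norm_num) (by norm_num) (by norm_num)
  -- In the window, `2 * f z = 2 * z - 1`. Outside it, monotonicity of `f` keeps both arguments on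
  -- the same constant part of the profile.
  have hfs : ∀ z, saddleProfile (2 * z - 1) = saddleProfile (2 * f z) := by
    intro z
    have v1 := f2 (2 / 3) (by norm_num) (by norm_num)
    have v2 := f2 (5 / 6) (by norm_num) (by norm_num)
    rcases le_total z (2 / 3) with h1 | h1
    · have := hf.strictMono.monotone h1
      rw [saddleProfile_bottom (by linarith), saddleProfile_bottom (by linarith)]
    rcases le_total z (5 / 6) with h2 | h2
    · rw [f2 z h1 h2]; ring_nf
    · have := hf.strictMono.monotone h2
      rw [saddleProfile_top (by linarith), saddleProfile_top (by linarith)]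
  have hgs : ∀ z, saddleProfile (2 * z) = saddleProfile (2 * g z - 1) := by
    intro z
    have v1 := g2 (1 / 6) (by norm_num) (by norm_num)
    have v2 := g2 (1 / 3) (by norm_num) (by norm_num)
    rcases le_total z (1 / 6) with h1 | h1
    · have := hg.strictMono.monotone h1
      rw [saddleProfile_bottom (by linarith), saddleProfile_bottom (by linarith)]
    rcases le_total z (1 / 3) with h2 | h2
    · rw [g2 z h1 h2]; ring_nf
    · have := hg.strictMono.monotone h2
      rw [saddleProfile_top (by linarith), saddleProfile_top (by linarith)]
  have m1 := min_le_left ε δ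
  have m2 := min_le_right ε δ
  -- All other crossings have constant parameters, so the identity serves for them.
  refine T.movie_isotopic (h := fun k => if k = j then f else if k = i then g else fun z => z)
    (fun k => ?_) (lt_min hε hδ) (fun k z hz => ?_) fun k z => ?_
  · split_ifs
    exacts [hf, hg, IsRepar.id]
  · split_ifs
    · exact f1 z (hz.imp (fun h => by linarith) fun h => by linarith)
    · exact g1 z (hz.imp (fun h => by linarith) fun h => by linarith)
    · rfl
  · unfold squareProfile
    split_ifs with h1 h2 h2
    · exact absurd (h2.symm.trans h1) hij
    · exact hfs z
    · exact hgs z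
    · rfl

/-- The squares of the cube commute. -/
theorem edge_comp_edge {v u u' w : Fin T.n → Bool} {i j : Fin T.n} (h : T.IsEdge v u j)
    (h' : T.IsEdge u w i) (k : T.IsEdge v u' i) (k' : T.IsEdge u' w j) (hij : i ≠ j) :
    T.edge h ≫ T.edge h' = T.edge k ≫ T.edge k' := by
  refine Quotient.sound ?_
  change IsIsotopic R ((T.saddle h).comp (T.saddle h')).carrier
    ((T.saddle k).comp (T.saddle k')).carrier
  -- Both movies depend only on `v` and the order of the two directions; the intermediate vertices
  -- have disappeared.
  rw [saddle_comp_carrier, saddle_comp_carrier]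
  exact T.squareProfile_isotopic v hij

/-! ### Edges and signs of the cube -/

/-- The companion path runs through the fourth vertex of the square face; it provides the involution
that cancels the terms of the squared differential. -/
theorem IsEdge.swap {T : TangleDiagram R B} {v u w : Fin T.n → Bool} {i j : Fin T.n}
    (h : T.IsEdge v u j) (h' : T.IsEdge u w i) :
    i ≠ j ∧ T.IsEdge v (Function.update v i true) i ∧ T.IsEdge (Function.update v i true) w j := by
  obtain ⟨h1, rfl⟩ := h
  obtain ⟨h2, rfl⟩ := h'
  have hij : i ≠ j := by
    rintro rfl
    simp at h2
  rw [Function.update_of_ne hij] at h2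
  exact ⟨hij, ⟨h2, rfl⟩, by rw [Function.update_of_ne hij.symm, h1],
    Function.update_comm hij.symm _ _ _⟩

theorem IsEdge.height {T : TangleDiagram R B} {v u : Fin T.n → Bool} {j : Fin T.n}
    (h : T.IsEdge v u j) : T.height u = T.height v + 1 := by
  obtain ⟨h1, rfl⟩ := h
  have e : (Finset.univ.filter fun i => Function.update v j true i = true) =
      insert j (Finset.univ.filter fun i => v i = true) := by
    ext i
    by_cases hij : i = j
    · subst hij; simp
    · simp [hij]
  rw [TangleDiagram.height, e, Finset.card_insert_of_notMem (by simp [h1])]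
  rfl

/-- The new one at `j` stands before `i`, so the count defining the sign grows by one. -/
theorem edgeSign_update_of_lt {v : Fin T.n → Bool} {i j : Fin T.n} (hj : v j = false)
    (hij : j < i) : T.edgeSign (Function.update v j true) i = -T.edgeSign v i := by
  have e : (Finset.univ.filter fun k => k < i ∧ Function.update v j true k = true) =
      insert j (Finset.univ.filter fun k => k < i ∧ v k = true) := by
    ext k
    by_cases hk : k = j
    · subst hk; simp [hij]
    · simp [hk]
  rw [edgeSign, e, Finset.card_insert_of_notMem (by simp [hj]), pow_succ, edgeSign]
  ring

theorem edgeSign_update_of_gt {v : Fin T.n → Bool} {i j : Fin T.n} (hij : i < j) :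
    T.edgeSign (Function.update v j true) i = T.edgeSign v i := by
  unfold edgeSign
  congr 2
  ext k
  by_cases hk : k = j
  · subst hk; simp [hij.not_gt]
  · simp [hk]

/-- The squares of the cube have an odd number of negative edges. -/
theorem edgeSign_square {v : Fin T.n → Bool} {i j : Fin T.n} (hi : v i = false) (hj : v j = false)
    (hij : i ≠ j) : T.edgeSign v j * T.edgeSign (Function.update v j true) i =
      -(T.edgeSign v i * T.edgeSign (Function.update v i true) j) := by
  -- In either order only one factor changes sign: the edge in the larger direction, after the
  -- smaller coordinate has been raised.
  rcases lt_or_gt_of_ne hij with h | h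
  · rw [T.edgeSign_update_of_gt h, T.edgeSign_update_of_lt hi h]; ring
  · rw [T.edgeSign_update_of_gt h, T.edgeSign_update_of_lt hj h]; ring

/-! ### The differential squares to zero -/

/-- This allows the intermediate vertex in a matrix product to range over the whole cube instead of
a single height. -/
theorem entry_eq_zero {v w : Fin T.n → Bool} (h : T.height w ≠ T.height v + 1) :
    T.entry v w = 0 :=
  Finset.sum_eq_zero fun _ _ => dif_neg fun hj => h hj.height

open scoped Classical in
/-- The summand of the matrix entry of the differential belonging to the direction `j`. -/
noncomputable def entryTerm (v w : Fin T.n → Bool) (j : Fin T.n) :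
    (Free.embedding ℤ (Smoothing R B)).obj (T.smoothing v) ⟶
      (Free.embedding ℤ (Smoothing R B)).obj (T.smoothing w) :=
  if h : T.IsEdge v w j then
    T.edgeSign v j • (Free.embedding ℤ (Smoothing R B)).map (T.edge h) else 0

theorem entryTerm_eq {v w : Fin T.n → Bool} {j : Fin T.n} (h : T.IsEdge v w j) :
    T.entryTerm v w j = T.edgeSign v j • (Free.embedding ℤ (Smoothing R B)).map (T.edge h) :=
  dif_pos h

theorem entryTerm_eq_zero {v w : Fin T.n → Bool} {j : Fin T.n} (h : ¬ T.IsEdge v w j) :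
    T.entryTerm v w j = 0 :=
  dif_neg h

/-- The two composites of the square are equal as morphisms, and their coefficients are opposite. -/
theorem entryTerm_swap {v u w : Fin T.n → Bool} {i j : Fin T.n} (h : T.IsEdge v u j)
    (h' : T.IsEdge u w i) : T.entryTerm v u j ≫ T.entryTerm u w i +
      T.entryTerm v (Function.update v i true) i ≫
        T.entryTerm (Function.update v i true) w j = 0 := by
  obtain ⟨hij, k, k'⟩ := h.swap h'
  rw [T.entryTerm_eq h, T.entryTerm_eq h', T.entryTerm_eq k, T.entryTerm_eq k']
  simp only [Preadditive.zsmul_comp, Preadditive.comp_zsmul, smul_smul, ← Functor.map_comp]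
  -- Once the composite is replaced by the one through the other vertex, `u` survives only inside a
  -- sign, where it can be rewritten as an update of `v`.
  rw [T.edge_comp_edge h h' k k' hij, ← add_smul, h.2, mul_comm,
    T.edgeSign_square k.1 h.1 hij]
  rw [mul_comm (T.edgeSign (Function.update v i true) j), neg_add_cancel, zero_smul]

/-- Expanding both entries by direction gives a sum over triples: an intermediate vertex, a first
direction and a second one. Exchanging the directions pairs off the actual paths, and each pair
cancels by `entryTerm_swap`. -/
theorem sum_entry_comp_entry (v w : Fin T.n → Bool) :
    ∑ u, T.entry v u ≫ T.entry u w = 0 := by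
  classical
  have e : ∑ u, T.entry v u ≫ T.entry u w =
      ∑ x : (Fin T.n → Bool) × Fin T.n × Fin T.n,
        T.entryTerm v x.1 x.2.1 ≫ T.entryTerm x.1 w x.2.2 := by
    rw [Fintype.sum_prod_type]
    refine Finset.sum_congr rfl fun u _ => ?_
    rw [Fintype.sum_prod_type]
    change (∑ j, T.entryTerm v u j) ≫ (∑ i, T.entryTerm u w i) = _
    rw [Preadditive.sum_comp]
    exact Finset.sum_congr rfl fun j _ => Preadditive.comp_sum _ _ _
  -- Triples that are not paths contribute zero, and they must be removed first: applying the
  -- exchange twice returns `Function.update v j true` as the middle vertex, which is `u` only when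
  -- there is an edge from `v` to `u`.
  rw [e, ← Finset.sum_filter_of_ne (p := fun x => T.IsEdge v x.1 x.2.1 ∧ T.IsEdge x.1 w x.2.2)]
  · refine Finset.sum_involution (fun x _ => (Function.update v x.2.2 true, x.2.2, x.2.1))
      ?_ ?_ ?_ ?_
    · rintro ⟨u, j, i⟩ hx
      obtain ⟨h, h'⟩ := (Finset.mem_filter.1 hx).2
      exact T.entryTerm_swap h h'
    · rintro ⟨u, j, i⟩ hx - he
      obtain ⟨h, h'⟩ := (Finset.mem_filter.1 hx).2
      -- A fixed triple would have equal directions, which no path has.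
      exact (h.swap h').1 (congrArg (fun x => x.2.1) he)
    · rintro ⟨u, j, i⟩ hx
      obtain ⟨h, h'⟩ := (Finset.mem_filter.1 hx).2
      exact Finset.mem_filter.2 ⟨Finset.mem_univ _, (h.swap h').2⟩
    · rintro ⟨u, j, i⟩ hx
      obtain ⟨h, h'⟩ := (Finset.mem_filter.1 hx).2
      exact Prod.ext h.2.symm rfl
  · rintro ⟨u, j, i⟩ - hne
    by_contra hc
    apply hne
    rcases not_and_or.1 hc with h | h
    · rw [T.entryTerm_eq_zero h, Limits.zero_comp]
    · rw [T.entryTerm_eq_zero h, Limits.comp_zero]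

/-- The matrix product sums over vertices of height `r + 1 + n₋` only. Other vertices are not one
step above `v`, so adding them changes nothing, and the sum over the whole cube vanishes. -/
theorem d_comp_d (r : ℤ) : T.d r ≫ T.d (r + 1) = 0 := by
  classical
  funext v w
  rw [Mat_.comp_apply]
  change ∑ u : {u : Fin T.n → Bool // (T.height u : ℤ) = r + 1 + T.nMinus},
    T.entry v.1 u.1 ≫ T.entry u.1 w.1 = 0
  rw [← T.sum_entry_comp_entry v.1 w.1]
  rw [← Finset.sum_filter_of_ne (s := Finset.univ)
    (p := fun u => (T.height u : ℤ) = r + 1 + T.nMinus)]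
  · exact (Finset.sum_subtype _ (fun u => by rw [Finset.mem_filter_univ])
      fun u => T.entry v.1 u ≫ T.entry u w.1).symm
  · intro u _ hne
    by_contra hc
    apply hne
    rw [T.entry_eq_zero, Limits.zero_comp]
    intro hu
    apply hc
    have := v.2
    rw [hu]
    push_cast
    linarith

/-! ### Finite length -/

theorem nPlus_add_nMinus : T.nPlus + T.nMinus = T.n := by
  have : (Finset.univ.filter fun j => T.crossingSign j = -1) =
      Finset.univ.filter fun j => ¬ T.crossingSign j = 1 :=
    Finset.filter_congr fun j _ => by
      rcases Int.units_eq_one_or (T.crossingSign j) with h | h <;> rw [h] <;> decide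
  rw [nPlus, nMinus, this, Finset.card_filter_add_card_filter_not, Finset.card_univ,
    Fintype.card_fin]

theorem height_le (v : Fin T.n → Bool) : T.height v ≤ T.n :=
  (Finset.card_le_univ _).trans_eq (Fintype.card_fin _)

/-- A vertex in degree `r` has height `r + n₋`, which must lie between `0` and `n₊ + n₋`. Outside
the stated degrees the formal sum is therefore empty, and a matrix without rows or without columns
is unique, which makes the object initial and terminal. -/
theorem isZero_chain {r : ℤ} (hr : r < -(T.nMinus : ℤ) ∨ (T.nPlus : ℤ) < r) :
    Limits.IsZero (T.chain r) := by
  have hι : (T.chain r).ι → False := by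
    rintro ⟨v, hv⟩
    have h1 := T.height_le v
    have h2 := T.nPlus_add_nMinus
    omega
  exact ⟨fun Y => ⟨⟨⟨fun i => (hι i).elim⟩, fun f => funext fun i => (hι i).elim⟩⟩,
    fun Y => ⟨⟨⟨fun _ i => (hι i).elim⟩, fun f => funext fun _ => funext fun i => (hι i).elim⟩⟩⟩

end TangleDiagram

end TangleBracket

theorem mainTheorem9 (R : TangleBracket.Region) (B : Finset TangleBracket.Plane)
    (T : TangleBracket.TangleDiagram R B) :
    (∀ r : ℤ, T.d r ≫ T.d (r + 1) = 0) ∧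
      ∀ r : ℤ, r < -(T.nMinus : ℤ) ∨ (T.nPlus : ℤ) < r → Limits.IsZero (T.chain r) :=
  ⟨T.d_comp_d, fun _ => T.isZero_chain⟩
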